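/- Let $n\ge 2$ and $0<d<n$. Let $G_{d,n}$ be the Grassmannian of all $d$-dimensional vector subspaces of $\mathbb{R}^n$, and let $G(d,n)$ be the affine Grassmannian, whose points are the $d$-planes $\sigma+x''$ with $\sigma\in G_{d,n}$ and $x''\in\sigma^\perp$, written $(\sigma,x'')$. For $f$ on $\mathbb{R}^n$ the $d$-plane transform is $\mathcal{R}_df(\sigma,x'')=\int_\sigma f(x'+x'')\,dx'$, where $dx'$ is Lebesgue measure on $\sigma$. The group $O(n)$ acts on $G_{d,n}$ by $k\cdot\sigma=\{kv:v\in\sigma\}$, and for a fixed $\sigma$ the stabilizer of $\sigma$ is $O(d)\times O(n-d)$ (acting on $\sigma\oplus\sigma^\perp$); $dk$ is the normalized invariant measure on $O(n)/(O(d)\times O(n-d))$, and $\pi_\sigma$ is the orthogonal projection onto $\sigma$. Write $\operatorname{vol}$ for Riemannian volume; $SO(m)$ carries the metric induced by the Frobenius inner product $\operatorname{tr}(A^{\mathsf T}B)$ on matrices, and $\mathbb{S}^k$ is the unit sphere in $\mathbb{R}^{k+1}$. Let $g$ be the $O(n)$-invariant Riemannian metric on $G_{d,n}$ given on $T_\sigma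 G_{d,n}=\operatorname{Hom}(\sigma,\sigma^\perp)$ by $\operatorname{tr}(L^{\mathsf T}M)$. For $s>0$ equip $G_{d,n}$ with the metric $s^2g$, write $\operatorname{vol}_s(G_{d,n})$ for its volume, and let $\int_{G(d,n)}\psi=\int_{G_{d,n}}\int_{\sigma^\perp}\psi(\sigma,x'')\,dx''\,d\sigma$, where $d\sigma$ is the Riemannian measure of $s^2g$. (1) Volumes. For all $k\ge0$, $\operatorname{vol}(\mathbb{S}^k)=2\pi^{(k+1)/2}/\Gamma((k+1)/2)$. Moreover $$V:=\frac{\operatorname{vol}(SO(n))}{2^{d(n-d)/2}\operatorname{vol}(SO(d))\operatorname{vol}(SO(n-d))}=\frac{\operatorname{vol}(\mathbb{S}^{n-1})\cdots\operatorname{vol}(\mathbb{S}^{n-d})}{\operatorname{vol}(\mathbb{S}^{d-1})\cdots\operatorname{vol}(\mathbb{S}^{1})}$$ (an empty product is $1$), and for every $s>0$ $$\operatorname{vol}_s(G_{d,n})=\frac{s^{d(n-d)}}{2}\,V .$$ In particular, for the scale with $s^{d(n-d)}=2$, $\operatorname{vol}_s(G_{d,n})=V$. (2) If $f:\mathbb{R}^n\to\mathbb{C}$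 is continuous with compact support, then the integrals defining $\mathcal{R}_df$ converge and $\mathcal{R}_df$ is continuous with compact support on $G(d,n)$. (3) Adjoint. Let $s>0$, let $\varphi:G(d,n)\to\mathbb{C}$ be continuous (in particular, $\varphi$ may be any compactly supported continuous function), fix any $\sigma\in G_{d,n}$, and put $$\mathcal{R}_d^*\varphi(x)=\operatorname{vol}_s(G_{d,n})\int_{O(n)/(O(d)\times O(n-d))}\varphi\bigl(k\cdot\sigma,\;x-\pi_{k\cdot\sigma}x\bigr)\,dk,\qquad x\in\mathbb{R}^n .$$ The integral converges for every $x$, $\mathcal{R}_d^*\varphi$ is continuous, and for all continuous compactly supported $f:\mathbb{R}^n\to\mathbb{C}$ the iterated integral on the left converges absolutely (the inner one for each $\sigma$, the outer one as an integral over $G_{d,n}$) and $$\int_{G(d,n)}\varphi\,\overline{\mathcal{R}_df}=\int_{\mathbb{R}^n}\mathcal{R}_d^*\varphi(x)\,\overline{f(x)}\,dx .$$ This determines $\mathcal{R}_d^*\varphi$: any locally integrable $h$ on $\mathbb{R}^n$ with $\int_{G(d,n)}\varphi\,\overline{\mathcal{R}_df}=\int h\,\overline{f}$ for all such $f$ equals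 $\mathcal{R}_d^*\varphi$ almost everywhere. -/

import Mathlib

open MeasureTheory
open scoped ComplexConjugate

noncomputable section

/-- `E n` is Euclidean `n`-space. -/
abbrev E (n : ℕ) : Type := EuclideanSpace ℝ (Fin n)

/-! ### Riemannian volumes

The Riemannian volume of a compact `m`-dimensional submanifold of a Euclidean space (with the
induced metric) is its `m`-dimensional Hausdorff measure `μHE[m]`, normalised so as to agree with
Lebesgue measure on `ℝ^m`. -/

/-- The volume of the unit sphere of dimension `k` in `ℝ^(k+1)`. -/
def volSphere (k : ℕ) : ℝ :=
  (μHE[k] (Metric.sphere (0 : E (k + 1)) 1)).toReal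

/-- A square matrix as a point of the Euclidean space of all its entries; the distance there is the
one of the Frobenius norm. -/
def matrixPoint {n : ℕ} (A : Matrix (Fin n) (Fin n) ℝ) : EuclideanSpace ℝ (Fin n × Fin n) :=
  WithLp.toLp 2 fun ij => A ij.1 ij.2

/-- The volume of `SO(n)`, a submanifold of dimension `n(n-1)/2` of the space of real `n × n`
matrices with the Frobenius inner product `tr(AᵀB)`. -/
def volSO (n : ℕ) : ℝ :=
  (μHE[n * (n - 1) / 2]
    (matrixPoint '' (Matrix.specialOrthogonalGroup (Fin n) ℝ : Set (Matrix (Fin n) (Fin n) ℝ)))).toReal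

/-! ### The Grassmannian -/

/-- The Grassmannian `G_{d,n}` of all `d`-dimensional vector subspaces of `ℝ^n`. -/
def Gr (d n : ℕ) : Type := {σ : Submodule ℝ (E n) // Module.finrank ℝ σ = d}

/-- The vector subspace which a point of `G_{d,n}` is. -/
def Gr.space {d n : ℕ} (σ : Gr d n) : Submodule ℝ (E n) := σ.1

/-- The matrix of the orthogonal projection `π_σ` of `ℝ^n` onto `σ`. -/
def Gr.projMatrix {d n : ℕ} (σ : Gr d n) : Matrix (Fin n) (Fin n) ℝ :=
  Matrix.of fun i j => (σ.space.starProjection (EuclideanSpace.single j 1)) i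

theorem Gr.projMatrix_injective {d n : ℕ} :
    Function.Injective (Gr.projMatrix : Gr d n → Matrix (Fin n) (Fin n) ℝ) := by
  intro σ τ h
  have h1 : σ.space.starProjection = τ.space.starProjection := by
    apply ContinuousLinearMap.coe_injective
    refine (EuclideanSpace.basisFun (Fin n) ℝ).toBasis.ext fun j => ?_
    ext i
    simpa [Gr.projMatrix] using congrFun (congrFun h i) j
  apply Subtype.ext
  have h2 : σ.space = τ.space := by
    rw [← Submodule.range_starProjection σ.space, ← Submodule.range_starProjection τ.space, h1]
  exact h2

/-- The embedding `σ ↦ π_σ / √2` of the Grassmannian into the Euclidean space of matrices. -/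
def Gr.embed {d n : ℕ} (σ : Gr d n) : EuclideanSpace ℝ (Fin n × Fin n) :=
  (Real.sqrt 2)⁻¹ • matrixPoint σ.projMatrix

theorem Gr.embed_injective {d n : ℕ} :
    Function.Injective (Gr.embed : Gr d n → EuclideanSpace ℝ (Fin n × Fin n)) := by
  intro σ τ h
  have hs : (Real.sqrt 2)⁻¹ ≠ 0 := by positivity
  have h1 := smul_right_injective _ hs h
  apply Gr.projMatrix_injective
  ext i j
  exact congrArg (fun v : EuclideanSpace ℝ (Fin n × Fin n) => v (i, j)) h1

/-- The distance `‖π_σ - π_τ‖ / √2` (Frobenius norm). A curve that leaves `σ` as the graph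
`{v + t L v : v ∈ σ}` of a linear map `L : σ → σ^⊥` has `π = π_σ + t (L + Lᵀ) + O(t²)`, so that this
is the distance induced by an embedding whose Riemannian metric on the tangent space
`T_σ G_{d,n} = Hom(σ, σ^⊥)` is the Hilbert-Schmidt inner product `tr(LᵀM)`. -/
instance Gr.instMetricSpace {d n : ℕ} : MetricSpace (Gr d n) :=
  MetricSpace.induced Gr.embed Gr.embed_injective inferInstance

instance Gr.instMeasurableSpace {d n : ℕ} : MeasurableSpace (Gr d n) := borel _

instance Gr.instBorelSpace {d n : ℕ} : BorelSpace (Gr d n) := ⟨rfl⟩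

/-- The Riemannian measure on `G_{d,n}`, a manifold of dimension `d(n-d)`, of the metric `s² g`
where `g` is the Hilbert-Schmidt metric `tr(LᵀM)` on `T_σ G_{d,n} = Hom(σ, σ^⊥)`. -/
def grMeasure (d n : ℕ) (s : ℝ) : Measure (Gr d n) :=
  ENNReal.ofReal (s ^ (d * (n - d))) • μHE[d * (n - d)]

/-- The Riemannian volume of `G_{d,n}` for the metric `s² g`. -/
def volGr (d n : ℕ) (s : ℝ) : ℝ := (grMeasure d n s Set.univ).toReal

/-! ### The action of the orthogonal group -/

/-- The orthogonal group `O(n)`. -/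
abbrev OG (n : ℕ) : Type := Matrix.orthogonalGroup (Fin n) ℝ

/-- The linear isometry of `ℝ^n` given by an orthogonal matrix, as a linear equivalence. -/
def OG.toEquiv {n : ℕ} (k : OG n) : E n ≃ₗ[ℝ] E n :=
  LinearEquiv.ofLinearMap (Matrix.toEuclideanLin k.1) (Matrix.toEuclideanLin (k⁻¹).1)
    (by rw [← Matrix.toLpLin_mul_same, ← Submonoid.coe_mul, mul_inv_cancel]; exact Matrix.toLpLin_one _)
    (by rw [← Matrix.toLpLin_mul_same, ← Submonoid.coe_mul, inv_mul_cancel]; exact Matrix.toLpLin_one _)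

/-- `O(n)` acts on `G_{d,n}` by `k · σ = {k v : v ∈ σ}`. -/
instance Gr.instMulAction {d n : ℕ} : MulAction (OG n) (Gr d n) where
  smul k σ := ⟨σ.space.map (Matrix.toEuclideanLin k.1),
    (LinearEquiv.finrank_map_eq (OG.toEquiv k) σ.space).trans σ.2⟩
  one_smul σ := Subtype.ext <| by
    change σ.space.map (Matrix.toEuclideanLin (1 : Matrix (Fin n) (Fin n) ℝ)) = σ.space
    rw [show Matrix.toEuclideanLin (1 : Matrix (Fin n) (Fin n) ℝ) = LinearMap.id from
      Matrix.toLpLin_one _, Submodule.map_id]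
  mul_smul k l σ := Subtype.ext <| by
    change σ.space.map (Matrix.toEuclideanLin (k.1 * l.1)) =
      (σ.space.map (Matrix.toEuclideanLin l.1)).map (Matrix.toEuclideanLin k.1)
    rw [← Submodule.map_comp]
    congr 1
    exact Matrix.toLpLin_mul_same _ _ _

instance OG.instCompactSpace {n : ℕ} : CompactSpace (OG n) := by
  have hK : IsCompact (Set.univ.pi fun _ : Fin n => Set.univ.pi fun _ : Fin n => Set.Icc (-1 : ℝ) 1) :=
    isCompact_univ_pi fun _ => isCompact_univ_pi fun _ => isCompact_Icc
  have hc : IsClosed ((Matrix.orthogonalGroup (Fin n) ℝ : Submonoid _) :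
      Set (Matrix (Fin n) (Fin n) ℝ)) := by
    have : ((Matrix.orthogonalGroup (Fin n) ℝ : Submonoid _) : Set (Matrix (Fin n) (Fin n) ℝ)) =
        {A | A * star A = 1} := by
      ext A; exact Matrix.mem_unitaryGroup_iff
    rw [this]
    exact isClosed_eq (continuous_id.mul continuous_star) continuous_const
  refine isCompact_iff_compactSpace.mp (IsCompact.of_isClosed_subset hK hc ?_)
  intro A hA i _ j _
  exact abs_le.mp (entry_norm_bound_of_unitary (𝕜 := ℝ) hA i j)

instance OG.instMeasurableSpace {n : ℕ} : MeasurableSpace (OG n) := borel _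

instance OG.instBorelSpace {n : ℕ} : BorelSpace (OG n) := ⟨rfl⟩

/-- The quotient `O(n)/(O(d) × O(n-d))`: the stabilizer of `σ` in `O(n)` is the product of the
orthogonal groups of `σ` and of `σ^⊥`. -/
abbrev OGQuot {d n : ℕ} (σ : Gr d n) : Type := OG n ⧸ MulAction.stabilizer (OG n) σ

/-- The point `k · σ` of `G_{d,n}`, for `k` in `O(n)/(O(d) × O(n-d))`. -/
def OGQuot.act {d n : ℕ} {σ : Gr d n} (k : OGQuot σ) : Gr d n :=
  MulAction.ofQuotientStabilizer (OG n) σ k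

/-- The normalized invariant measure `dk` on `O(n)/(O(d) × O(n-d))`: the image of the Haar measure
of total mass one on `O(n)`. -/
def invMeasure {d n : ℕ} (σ : Gr d n) : Measure (OGQuot σ) :=
  (Measure.haarMeasure (⊤ : TopologicalSpace.PositiveCompacts (OG n))).map QuotientGroup.mk

/-! ### The affine Grassmannian and the `d`-plane transform -/

/-- The affine Grassmannian `G(d,n)`: the `d`-plane `σ + x''`, with `σ ∈ G_{d,n}` and
`x'' ∈ σ^⊥`, is written `(σ, x'')`. The topology is that of a subspace of `G_{d,n} × ℝ^n`. -/
abbrev AffGr (d n : ℕ) : Type := {p : Gr d n × E n // p.2 ∈ p.1.spaceᗮ}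

/-- The point `(σ, x'')` of `G(d,n)`. -/
def AffGr.mk {d n : ℕ} (σ : Gr d n) (x : σ.spaceᗮ) : AffGr d n := ⟨(σ, x.1), x.2⟩

/-- The `d`-plane `σ + x''` as a set of points. -/
def AffGr.plane {d n : ℕ} (p : AffGr d n) : AffineSubspace ℝ (E n) :=
  AffineSubspace.mk' p.1.2 p.1.1.space

/-- The pairs `(σ, x'')` are in bijection with the `d`-dimensional affine subspaces of `ℝ^n`. -/
theorem AffGr.existsUnique_plane {d n : ℕ} (A : AffineSubspace ℝ (E n))
    (hA : (A : Set (E n)).Nonempty) (hd : Module.finrank ℝ A.direction = d) :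
    ∃! p : AffGr d n, p.plane = A := by
  obtain ⟨a, ha⟩ := hA
  let σ : Gr d n := ⟨A.direction, hd⟩
  have hσ : σ.space = A.direction := rfl
  refine ⟨AffGr.mk σ ⟨a - σ.space.starProjection a,
    Submodule.sub_starProjection_mem_orthogonal a⟩, ?_, ?_⟩
  · change AffineSubspace.mk' (a - σ.space.starProjection a) A.direction = A
    refine (AffineSubspace.eq_of_direction_eq_of_nonempty_of_le ?_ ?_ ?_)
    · simp
    · exact ⟨_, AffineSubspace.self_mem_mk' _ _⟩
    · intro z hz
      rw [AffineSubspace.mem_mk'] at hz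
      have h1 : z -ᵥ a ∈ A.direction := by
        have := A.direction.sub_mem hz (Submodule.starProjection_apply_mem σ.space a)
        rw [vsub_eq_sub] at this ⊢
        convert this using 1
        abel
      simpa using AffineSubspace.vadd_mem_of_mem_direction h1 ha
  · rintro ⟨⟨τ, y⟩, hy⟩ h
    have hdir : τ.space = A.direction := by
      rw [← h]; exact (AffineSubspace.direction_mk' _ _).symm
    have hτ : τ = σ := Subtype.ext hdir
    subst hτ
    have hy' : y ∈ σ.spaceᗮ := hy
    have hya : a - y ∈ σ.space := by
      have : a ∈ AffineSubspace.mk' y σ.space := by rw [← h] at ha; exact ha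
      simpa [AffineSubspace.mem_mk'] using this
    apply Subtype.ext
    apply Prod.ext
    · rfl
    · change y = a - σ.space.starProjection a
      have : σ.space.starProjection a = a - y := by
        apply Submodule.eq_starProjection_of_mem_of_inner_eq_zero hya
        intro w hw
        rw [sub_sub_cancel, real_inner_comm]
        exact hy' w hw
      rw [this, sub_sub_cancel]

/-- The `d`-plane transform: `(R_d f)(σ, x'') = ∫_σ f(x' + x'') dx'`. -/
def dPlane {d n : ℕ} (f : E n → ℂ) (p : AffGr d n) : ℂ :=
  ∫ x' : p.1.1.space, f (x' + p.1.2)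

/-- The point `(σ, x - π_σ x)` of `G(d,n)`: the `d`-plane through `x` parallel to `σ`. -/
def AffGr.through {d n : ℕ} (σ : Gr d n) (x : E n) : AffGr d n :=
  AffGr.mk σ ⟨x - σ.space.starProjection x, Submodule.sub_starProjection_mem_orthogonal x⟩

/-- The pairing `∫_{G(d,n)} φ ψ̄`, where `G(d,n)` carries the Riemannian measure of `(G_{d,n}, s² g)`
in `σ` and Lebesgue measure on `σ^⊥` in `x''`. -/
def affPairing {d n : ℕ} (s : ℝ) (φ ψ : AffGr d n → ℂ) : ℂ :=
  ∫ σ, (∫ x'' : σ.spaceᗮ, φ (AffGr.mk σ x'') * conj (ψ (AffGr.mk σ x''))) ∂(grMeasure d n s)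

/-- `h` is the value at `φ` of the adjoint of `R_d`: `⟨φ, R_d f⟩ = ⟨h, f⟩` for all compactly
supported continuous `f` on `ℝ^n`. -/
def IsAdjointValue {d n : ℕ} (s : ℝ) (φ : AffGr d n → ℂ) (h : E n → ℂ) : Prop :=
  ∀ f : E n → ℂ, Continuous f → HasCompactSupport f →
    affPairing s φ (dPlane f) = ∫ x, h x * conj (f x)

end

/-!
The proof has two independent parts, the volume formulas and the adjoint of the `d`-plane transform.
What they share is `eq_smul_map_of_invariant`: a finite `O(n)`-invariant measure carried by a single
orbit is the image of Haar measure on `O(n)`, multiplied by its total mass. It is Fubini's theorem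
on the product of the group and the orbit.

**Volumes.** The groups `O(n)`, the Grassmannian and the sphere are orbits of isometric actions of
orthogonal groups, so that their Hausdorff measures are multiples of the image of Haar measure, as
soon as they are finite; for finiteness the orbits are exhibited as level sets. The multiple is the
volume, and it can be read off at a single point: if a chart around the base point is a similarity
of ratio `c` to first order (`IsApproxSimilarity`), then small cubes have images whose measure is
asymptotic to `c ^ m` times the volume of the cube (`IsApproxSimilarity.tendsto_measure_image_box`),
and hence `volume * Haar measure ~ c ^ m * (2 r) ^ m` (`tendsto_orbit_measure`). No change of
variables formula on manifolds is needed, only strict derivatives at one point; the charts are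
exponentials of skew-symmetric matrices.

In a chart adapted to the fibration `O(e + d) → G_{d,e+d}` with fibre `O(e) × O(d)`, Haar measure is
a product (`measure_image_section_mul`). Comparison of the asymptotics gives `volO_add`,
`vol O(e + d) = 2 ^ (e d / 2) vol G_{d,e+d} vol O(e) vol O(d)`,
where `2 ^ (e d / 2)` is due to the two off-diagonal blocks of a skew-symmetric matrix, which both
count in the Frobenius norm. For `d = 1` the Grassmannian is the space of lines, which the sphere
covers twice (`volSphere_eq_two_mul_volGrassmannian`), and an induction on `d` yields the product
formula `two_mul_volGrassmannian`. The factor `1 / 2` in the volume of the Grassmannian comes from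
`vol O(n) = 2 vol SO(n)`. The volume of the sphere itself follows from that of the ball
(`volSphere_eq_mul_volume_ball`), by the same method, with polar coordinates as the chart.

**The transform and its adjoint.** The integral of `f` over the plane `σ + x` depends continuously
on `(σ, x)`: the map `(k, x) ↦ (k • σ₀, x)` is a quotient map because `O(n)` is compact, and over
`O(n)` the integral is one over the fixed space `σ₀` (`continuous_planeIntegral`). Planes that meet
a closed ball form a compact set, which gives the compact support. By Fubini's theorem on
`ℝ^n = σ ⊕ σ^⊥`, the inner integral of the pairing is the integral over `ℝ^n` of `φ(σ, x - π_σ x)`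
against the conjugate of `f` (`integral_orthogonal_mul_conj_dPlane`); now the integrals over `ℝ^n`
and the compact Grassmannian are interchanged, and the one over the Grassmannian is rewritten as one
over the homogeneous space (`integral_grMeasure`). Uniqueness is the fundamental lemma of the
calculus of variations.
-/

noncomputable section

open MeasureTheory Filter Topology Set
open scoped ComplexConjugate ENNReal NNReal

/-! ### Hausdorff measure of images of small boxes -/

/-- The cube of half-width `r` centred at the origin. -/
def box (κ : Type*) [Fintype κ] (r : ℝ) : Set (EuclideanSpace ℝ κ) :=
  {x | ∀ i, x i ∈ Icc (-r) r}

theorem box_eq_preimage (κ : Type*) [Fintype κ] (r : ℝ) :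
    box κ r = WithLp.ofLp ⁻¹' (univ.pi fun _ : κ => Icc (-r) r) := by
  ext x; simp only [box, mem_preimage, mem_univ_pi, mem_ofPred_eq]

theorem isCompact_box (κ : Type*) [Fintype κ] (r : ℝ) : IsCompact (box κ r) := by
  rw [box_eq_preimage]
  have : IsCompact (univ.pi fun _ : κ => Icc (-r) r) := isCompact_univ_pi fun _ => isCompact_Icc
  exact (PiLp.homeomorph 2 (fun _ : κ => ℝ)).isCompact_preimage.2 this

theorem euclideanHausdorffMeasure_eq_volume_of_card {κ : Type*} [Fintype κ] {m : ℕ}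
    (hm : Fintype.card κ = m) : (μHE[m] : Measure (EuclideanSpace ℝ κ)) = volume := by
  rw [← InnerProductSpace.euclideanHausdorffMeasure_eq_volume (V := EuclideanSpace ℝ κ),
    finrank_euclideanSpace, hm]

theorem volume_box (κ : Type*) [Fintype κ] (r : ℝ) :
    volume (box κ r) = ENNReal.ofReal (2 * r) ^ Fintype.card κ := by
  rw [box_eq_preimage, (PiLp.volume_preserving_ofLp κ).measure_preimage
    (MeasurableSet.univ_pi fun _ => measurableSet_Icc).nullMeasurableSet, volume_pi_pi]
  simp [two_mul]

theorem eventually_forall_mem_box {κ : Type*} [Fintype κ] {p : EuclideanSpace ℝ κ → Prop}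
    (h : ∀ᶠ x in 𝓝 0, p x) : ∀ᶠ r in 𝓝[>] (0 : ℝ), ∀ x ∈ box κ r, p x := by
  have h1 : ∀ᶠ q : κ → ℝ in 𝓝 0, p (WithLp.toLp 2 q) :=
    (PiLp.continuous_toLp 2 _).continuousAt.eventually (by simpa using h)
  obtain ⟨δ, hδ, H⟩ := Metric.eventually_nhds_iff.1 h1
  have : Ioo (0 : ℝ) δ ∈ 𝓝[>] (0 : ℝ) := Ioo_mem_nhdsGT hδ
  filter_upwards [this] with r hr x hx
  refine H (y := WithLp.ofLp x) ((dist_pi_lt_iff hδ).2 fun i => ?_)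
  have := abs_le.2 (hx i)
  simpa using this.trans_lt hr.2

/-- `F` is, infinitesimally at the origin, a similarity of ratio `c`. The definition refers only to
distances, so that it applies to maps into a space such as the Grassmannian, which carries a metric
but no linear structure. -/
def IsApproxSimilarity {V Y : Type*} [NormedAddCommGroup V] [MetricSpace Y] (F : V → Y) (c : ℝ) :
    Prop :=
  ∀ ε > 0, ∃ U ∈ 𝓝 (0 : V), ∀ x ∈ U, ∀ y ∈ U, |dist (F x) (F y) - c * dist x y| ≤ ε * dist x y

/-- Strict differentiability is what makes a conformal derivative control the distance of any two
nearby points, not just that of a point to the origin. -/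
theorem HasStrictFDerivAt.isApproxSimilarity {V Y : Type*} [NormedAddCommGroup V] [NormedSpace ℝ V]
    [NormedAddCommGroup Y] [NormedSpace ℝ Y] {F : V → Y} {L : V →L[ℝ] Y} {c : ℝ}
    (hF : HasStrictFDerivAt F L 0) (hL : ∀ v, ‖L v‖ = c * ‖v‖) : IsApproxSimilarity F c := by
  intro ε hε
  have h := hF.isLittleO.def hε
  rw [nhds_prod_eq] at h
  obtain ⟨U, hU, H⟩ := eventually_prod_self_iff
    (r := fun x y => ‖F x - F y - L (x - y)‖ ≤ ε * ‖x - y‖) |>.1 h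
  refine ⟨U, hU, fun x hx y hy => ?_⟩
  rw [dist_eq_norm, dist_eq_norm, ← hL]
  exact (abs_norm_sub_norm_le _ _).trans (H x hx y hy)

theorem LipschitzOnWith.euclideanHausdorffMeasure_image_le {X Y : Type*} [MetricSpace X]
    [MetricSpace Y] [MeasurableSpace X] [BorelSpace X] [MeasurableSpace Y] [BorelSpace Y]
    {f : X → Y} {s : Set X} {K : ℝ≥0} (h : LipschitzOnWith K f s) (m : ℕ) :
    μHE[m] (f '' s) ≤ (K : ℝ≥0∞) ^ m * μHE[m] s := by
  simp only [Measure.euclideanHausdorffMeasure_def, Measure.smul_apply]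
  have := h.hausdorffMeasure_image_le (d := m) (by positivity)
  rw [ENNReal.rpow_natCast] at this
  rw [ENNReal.smul_def, ENNReal.smul_def, smul_eq_mul, smul_eq_mul, mul_left_comm]
  gcongr

/-- A map that contracts distances by at most the factor `K⁻¹` on `s` shrinks the `m`-dimensional
measure by at most `K⁻¹ ^ m`: the inverse map is `K`-Lipschitz. -/
theorem le_euclideanHausdorffMeasure_image {X Y : Type*} [MetricSpace X] [MetricSpace Y]
    [MeasurableSpace X] [BorelSpace X] [MeasurableSpace Y] [BorelSpace Y]
    {f : X → Y} {s : Set X} {K : ℝ≥0} (h : ∀ x ∈ s, ∀ y ∈ s, dist x y ≤ K * dist (f x) (f y))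
    (m : ℕ) : μHE[m] s ≤ (K : ℝ≥0∞) ^ m * μHE[m] (f '' s) := by
  rcases s.eq_empty_or_nonempty with rfl | ⟨x₀, -⟩
  · simp
  have : Nonempty X := ⟨x₀⟩
  have hinj : InjOn f s := fun x hx y hy hxy => by
    have := h x hx y hy
    rw [hxy, dist_self, mul_zero] at this
    exact dist_le_zero.1 this
  have hl : LipschitzOnWith K (Function.invFunOn f s) (f '' s) := by
    refine LipschitzOnWith.of_dist_le_mul ?_
    rintro _ ⟨x, hx, rfl⟩ _ ⟨y, hy, rfl⟩
    rw [hinj.leftInvOn_invFunOn hx, hinj.leftInvOn_invFunOn hy]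
    exact h x hx y hy
  have := hl.euclideanHausdorffMeasure_image_le m
  rwa [hinj.leftInvOn_invFunOn.image_image] at this

namespace IsApproxSimilarity

variable {κ : Type*} [Fintype κ] {Y : Type*} [MetricSpace Y] {F : EuclideanSpace ℝ κ → Y} {c : ℝ}

theorem eventually_box (hF : IsApproxSimilarity F c) {ε : ℝ} (hε : 0 < ε) :
    ∀ᶠ r in 𝓝[>] (0 : ℝ), ∀ x ∈ box κ r, ∀ y ∈ box κ r,
      |dist (F x) (F y) - c * dist x y| ≤ ε * dist x y := by
  obtain ⟨U, hU, H⟩ := hF ε hε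
  filter_upwards [eventually_forall_mem_box (p := (· ∈ U)) hU] with r hr x hx y hy
  exact H x (hr x hx) y (hr y hy)

theorem eventually_injOn (hF : IsApproxSimilarity F c) (hc : 0 < c) :
    ∀ᶠ r in 𝓝[>] (0 : ℝ), InjOn F (box κ r) := by
  filter_upwards [hF.eventually_box (half_pos hc)] with r hr x hx y hy hxy
  have := hr x hx y hy
  rw [hxy, dist_self, zero_sub, abs_neg] at this
  have h2 := (le_abs_self _).trans this
  have h3 : dist x y ≤ 0 := by nlinarith
  exact dist_le_zero.1 h3

theorem eventually_continuousOn (hF : IsApproxSimilarity F c) :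
    ∀ᶠ r in 𝓝[>] (0 : ℝ), ContinuousOn F (box κ r) := by
  filter_upwards [hF.eventually_box one_pos] with r hr
  refine (LipschitzOnWith.of_dist_le_mul (K := (1 + |c|).toNNReal) fun x hx y hy => ?_).continuousOn
  have := (abs_le.1 (hr x hx y hy)).2
  rw [Real.coe_toNNReal _ (by positivity)]
  nlinarith [le_abs_self c, dist_nonneg (x := x) (y := y)]

theorem eventually_isCompact (hF : IsApproxSimilarity F c) :
    ∀ᶠ r in 𝓝[>] (0 : ℝ), IsCompact (F '' box κ r) := by
  filter_upwards [hF.eventually_continuousOn] with r hr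
  exact (isCompact_box κ r).image_of_continuousOn hr

theorem eventually_bounds [MeasurableSpace Y] [BorelSpace Y] (hF : IsApproxSimilarity F c)
    {ε : ℝ} (hε : 0 < ε) (hεc : ε < c) {m : ℕ} (hm : Fintype.card κ = m) :
    ∀ᶠ r in 𝓝[>] (0 : ℝ),
      (c - ε) ^ m ≤ (μHE[m] (F '' box κ r)).toReal / (2 * r) ^ m ∧
        (μHE[m] (F '' box κ r)).toReal / (2 * r) ^ m ≤ (c + ε) ^ m := by
  filter_upwards [hF.eventually_box hε, self_mem_nhdsWithin] with r hr hr0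
  have hr0 : 0 < r := hr0
  have hvol : (μHE[m] : Measure (EuclideanSpace ℝ κ)) (box κ r) = ENNReal.ofReal ((2 * r) ^ m) := by
    rw [euclideanHausdorffMeasure_eq_volume_of_card hm, volume_box, hm,
      ENNReal.ofReal_pow (by positivity)]
  have hup : μHE[m] (F '' box κ r) ≤ ENNReal.ofReal ((c + ε) ^ m * (2 * r) ^ m) := by
    have hl : LipschitzOnWith (c + ε).toNNReal F (box κ r) :=
      LipschitzOnWith.of_dist_le_mul fun x hx y hy => by
        rw [Real.coe_toNNReal _ (by linarith)]
        linarith [(abs_le.1 (hr x hx y hy)).2]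
    refine (hl.euclideanHausdorffMeasure_image_le m).trans_eq ?_
    have hpos : 0 < c + ε := by linarith
    rw [hvol, ENNReal.ofReal_mul (by positivity), ENNReal.ofReal_pow hpos.le]
    rfl
  have hlow : ENNReal.ofReal ((c - ε) ^ m * (2 * r) ^ m) ≤ μHE[m] (F '' box κ r) := by
    have hpos : 0 < c - ε := by linarith
    have := le_euclideanHausdorffMeasure_image (f := F) (s := box κ r) (K := (c - ε)⁻¹.toNNReal)
      (fun x hx y hy => by
        rw [Real.coe_toNNReal _ (by positivity), inv_mul_eq_div, le_div_iff₀ hpos]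
        linarith [(abs_le.1 (hr x hx y hy)).1]) m
    rw [hvol] at this
    calc ENNReal.ofReal ((c - ε) ^ m * (2 * r) ^ m)
        = ENNReal.ofReal (c - ε) ^ m * ENNReal.ofReal ((2 * r) ^ m) := by
          rw [ENNReal.ofReal_mul (by positivity), ENNReal.ofReal_pow hpos.le]
      _ ≤ ENNReal.ofReal (c - ε) ^ m *
            (((c - ε)⁻¹.toNNReal : ℝ≥0∞) ^ m * μHE[m] (F '' box κ r)) := by gcongr
      _ = μHE[m] (F '' box κ r) := by
          rw [← mul_assoc, ← mul_pow]
          change (ENNReal.ofReal (c - ε) * ENNReal.ofReal (c - ε)⁻¹) ^ m * _ = _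
          rw [← ENNReal.ofReal_mul hpos.le, mul_inv_cancel₀ hpos.ne']
          simp
  have hfin : μHE[m] (F '' box κ r) ≠ ∞ := ne_top_of_le_ne_top ENNReal.ofReal_ne_top hup
  constructor
  · rw [le_div_iff₀ (by positivity)]
    exact (ENNReal.ofReal_le_iff_le_toReal hfin).1 hlow
  · rw [div_le_iff₀ (by positivity)]
    refine ENNReal.toReal_le_of_le_ofReal ?_ hup
    have : 0 < c + ε := by linarith
    positivity

/-- The density theorem: the `m`-dimensional measure of the image of a small cube is, to leading
order, the volume of the cube multiplied by `c ^ m`. -/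
theorem tendsto_measure_image_box [MeasurableSpace Y] [BorelSpace Y] (hF : IsApproxSimilarity F c)
    (hc : 0 < c) {m : ℕ} (hm : Fintype.card κ = m) :
    Tendsto (fun r : ℝ => (μHE[m] (F '' box κ r)).toReal / (2 * r) ^ m) (𝓝[>] 0) (𝓝 (c ^ m)) := by
  have hcont : ∀ σ : ℝ, Tendsto (fun ε : ℝ => (c + σ * ε) ^ m) (𝓝[>] 0) (𝓝 (c ^ m)) := fun σ => by
    have : Continuous fun ε : ℝ => (c + σ * ε) ^ m := by fun_prop
    simpa using (this.tendsto 0).mono_left nhdsWithin_le_nhds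
  have hsmall : Ioo (0 : ℝ) c ∈ 𝓝[>] (0 : ℝ) := Ioo_mem_nhdsGT hc
  refine tendsto_order.2 ⟨fun a ha => ?_, fun a ha => ?_⟩
  · obtain ⟨ε, h1, h2⟩ := (((hcont (-1)).eventually (lt_mem_nhds ha)).and hsmall).exists
    filter_upwards [hF.eventually_bounds h2.1 h2.2 hm] with r hr
    refine lt_of_lt_of_le ?_ hr.1
    simpa [sub_eq_add_neg] using h1
  · obtain ⟨ε, h1, h2⟩ := (((hcont 1).eventually (gt_mem_nhds ha)).and hsmall).exists
    filter_upwards [hF.eventually_bounds h2.1 h2.2 hm] with r hr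
    refine lt_of_le_of_lt hr.2 ?_
    simpa using h1

end IsApproxSimilarity

/-! ### Invariant measures on orbits of a compact group -/

theorem isCompact_orbit {G Y : Type*} [Group G] [TopologicalSpace G] [CompactSpace G]
    [TopologicalSpace Y] [MulAction G Y] [ContinuousSMul G Y] (x₀ : Y) :
    IsCompact (MulAction.orbit G x₀) :=
  isCompact_range (continuous_id.smul continuous_const)

section Invariant

variable {G : Type*} [Group G] [TopologicalSpace G] [IsTopologicalGroup G]
  [SecondCountableTopology G] [MeasurableSpace G] [BorelSpace G]

/-- A finite invariant measure carried by one orbit is determined by its total mass. -/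
theorem eq_smul_map_of_invariant {Y : Type*} [TopologicalSpace Y] [SecondCountableTopology Y]
    [MeasurableSpace Y] [BorelSpace Y] [MulAction G Y] [ContinuousSMul G Y]
    (μ : Measure G) [IsProbabilityMeasure μ] [μ.IsMulRightInvariant]
    (ν : Measure Y) [IsFiniteMeasure ν] (hν : ∀ g : G, ν.map (g • ·) = ν) (x₀ : Y)
    (h0 : ν (MulAction.orbit G x₀)ᶜ = 0) :
    ν = ν univ • μ.map (fun g => g • x₀) := by
  ext S hS
  have hms : Measurable fun p : G × Y => p.1 • p.2 := continuous_smul.measurable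
  have hm0 : Measurable fun g : G => g • x₀ := (continuous_id.smul continuous_const).measurable
  have hA : MeasurableSet {p : G × Y | p.1 • p.2 ∈ S} := hms hS
  -- Fubini for the indicator of `{(g, y) | g • y ∈ S}`
  have h1 : ∫⁻ g, ν {y | g • y ∈ S} ∂μ = ∫⁻ y, μ {g | g • y ∈ S} ∂ν := by
    have e1 := Measure.prod_apply (μ := μ) (ν := ν) hA
    have e2 := Measure.prod_apply_symm (μ := μ) (ν := ν) hA
    exact e1.symm.trans e2
  have h2 : ∀ g : G, ν {y | g • y ∈ S} = ν S := fun g => by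
    conv_rhs => rw [← hν g]
    rw [Measure.map_apply (continuous_const_smul g).measurable hS]
    rfl
  have h3 : ∀ᵐ y ∂ν, μ {g | g • y ∈ S} = μ.map (fun g => g • x₀) S := by
    filter_upwards [mem_ae_iff.2 h0] with y hy
    obtain ⟨k, rfl⟩ := hy
    rw [Measure.map_apply hm0 hS]
    have := measure_preimage_mul_right μ k ((fun g : G => g • x₀) ⁻¹' S)
    rw [← this]
    congr 1
    ext g
    simp [mul_smul]
  simp only [h2] at h1
  rw [lintegral_congr_ae h3] at h1
  simpa [mul_comm] using h1

/-- The integration formula for a fibration `G → G/K`, on product sets: `K` is the stabilizer of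
`x₀`, and `s` a section over `V`. -/
theorem measure_image_section_mul {K Y P : Type*} [Group K] [TopologicalSpace K]
    [IsTopologicalGroup K] [SecondCountableTopology K] [MeasurableSpace K] [BorelSpace K]
    [MulAction G Y]
    (μ : Measure G) [IsProbabilityMeasure μ] [μ.IsMulRightInvariant]
    (κ : Measure K) [IsProbabilityMeasure κ] [κ.IsMulLeftInvariant]
    (j : K →* G) (hj : Continuous j) (hinj : Function.Injective j) (x₀ : Y)
    (hstab : ∀ g : G, g • x₀ = x₀ ↔ g ∈ Set.range j) (s : P → G) (V : Set P)
    (hV : InjOn (fun v => s v • x₀) V) (H : Set K)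
    (hmV : MeasurableSet {g : G | g • x₀ ∈ (fun v => s v • x₀) '' V})
    (hW : MeasurableSet (image2 (fun v h => s v * j h) V H)) :
    μ (image2 (fun v h => s v * j h) V H) =
      μ {g : G | g • x₀ ∈ (fun v => s v • x₀) '' V} * κ H := by
  set W := image2 (fun v h => s v * j h) V H with hWdef
  set A := {g : G | g • x₀ ∈ (fun v => s v • x₀) '' V} with hAdef
  have hmul : Measurable fun p : G × K => p.1 * j p.2 :=
    (continuous_fst.mul (hj.comp continuous_snd)).measurable
  have hmeas : MeasurableSet {p : G × K | p.1 * j p.2 ∈ W} := hmul hW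
  have h1 : ∫⁻ g, κ {h | g * j h ∈ W} ∂μ = ∫⁻ h, μ {g | g * j h ∈ W} ∂κ := by
    have e1 := Measure.prod_apply (μ := μ) (ν := κ) hmeas
    have e2 := Measure.prod_apply_symm (μ := μ) (ν := κ) hmeas
    exact e1.symm.trans e2
  have h2 : ∀ h : K, μ {g | g * j h ∈ W} = μ W := fun h =>
    measure_preimage_mul_right μ (j h) W
  have hfix : ∀ h : K, j h • x₀ = x₀ := fun h => (hstab _).2 ⟨h, rfl⟩
  have h3 : ∀ g : G, κ {h | g * j h ∈ W} = A.indicator (fun _ => κ H) g := fun g => by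
    by_cases hg : g ∈ A
    · rw [indicator_of_mem hg]
      obtain ⟨v, hv, hvg⟩ := hg
      have hvg : s v • x₀ = g • x₀ := hvg
      obtain ⟨h₀, hh₀⟩ := (hstab ((s v)⁻¹ * g)).1 (by rw [mul_smul, ← hvg, inv_smul_smul])
      have hg' : g = s v * j h₀ := by rw [hh₀, mul_inv_cancel_left]
      rw [← measure_preimage_mul κ h₀ H]
      congr 1
      ext h
      constructor
      · rintro ⟨v', hv', h', hh', he⟩
        have hv'' : v' = v := by
          refine hV hv' hv ?_
          have := congrArg (fun g : G => g • x₀) he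
          simpa [mul_smul, hfix, hg'] using this
        subst hv''
        have : h' = h₀ * h := by
          apply hinj
          have he : s v' * j h' = g * j h := he
          rw [hg', mul_assoc, ← map_mul] at he
          exact mul_left_cancel he
        rw [this] at hh'
        exact hh'
      · intro hh
        exact ⟨v, hv, h₀ * h, hh, by simp [hg', mul_assoc]⟩
    · rw [indicator_of_notMem hg]
      have : {h | g * j h ∈ W} = ∅ := by
        refine eq_empty_of_forall_notMem fun h => ?_
        rintro ⟨v', hv', h', hh', he⟩
        refine hg ⟨v', hv', ?_⟩
        have := congrArg (fun g : G => g • x₀) he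
        simpa [mul_smul, hfix] using this
      rw [this, measure_empty]
  simp only [h2, h3, lintegral_const, measure_univ, mul_one] at h1
  rw [← h1, lintegral_indicator_const hmV, mul_comm]

variable [CompactSpace G] {Y : Type*} [MetricSpace Y] [SecondCountableTopology Y]
    [MeasurableSpace Y] [BorelSpace Y] [MulAction G Y] [ContinuousSMul G Y] [IsIsometricSMul G Y]

/-- Hausdorff measure on an orbit is invariant, hence a multiple of the image of Haar measure. -/
theorem euclideanHausdorffMeasure_restrict_orbit (μ : Measure G) [IsProbabilityMeasure μ]
    [μ.IsMulRightInvariant] (m : ℕ) (x₀ : Y) (hfin : μHE[m] (MulAction.orbit G x₀) ≠ ∞) :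
    (μHE[m]).restrict (MulAction.orbit G x₀) =
      μHE[m] (MulAction.orbit G x₀) • μ.map (fun g => g • x₀) := by
  have hmeas : MeasurableSet (MulAction.orbit G x₀) :=
    (isCompact_orbit (G := G) x₀).isClosed.measurableSet
  have : IsFiniteMeasure ((μHE[m]).restrict (MulAction.orbit G x₀)) :=
    ⟨by rw [Measure.restrict_apply_univ]; exact hfin.lt_top⟩
  have h := eq_smul_map_of_invariant μ ((μHE[m]).restrict (MulAction.orbit G x₀)) (fun g => ?_) x₀
    (by rw [Measure.restrict_apply hmeas.compl]; simp)
  · rwa [Measure.restrict_apply_univ] at h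
  · ext S hS
    rw [Measure.map_apply (continuous_const_smul g).measurable hS,
      Measure.restrict_apply ((continuous_const_smul g).measurable hS), Measure.restrict_apply hS]
    have hp := (IsometryEquiv.constSMul (X := Y) g).measurePreserving_euclideanHausdorffMeasure m
    have := hp.measure_preimage (hS.inter hmeas).nullMeasurableSet
    rw [← this]
    congr 1
    ext y
    have : g • y ∈ MulAction.orbit G x₀ ↔ y ∈ MulAction.orbit G x₀ :=
      ⟨fun h => by simpa using MulAction.mem_orbit_of_mem_orbit g⁻¹ h,
        MulAction.mem_orbit_of_mem_orbit g⟩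
    simp [this]

/-- The total measure of an orbit is found by comparing, for a parametrization `F` of it, small
cubes with the Haar measure of the group elements that move the base point into their image. -/
theorem tendsto_orbit_measure (μ : Measure G) [IsProbabilityMeasure μ]
    [μ.IsMulRightInvariant] {κ : Type*} [Fintype κ] {m : ℕ} (hm : Fintype.card κ = m) (x₀ : Y)
    (hfin : μHE[m] (MulAction.orbit G x₀) ≠ ∞) {F : EuclideanSpace ℝ κ → Y} {c : ℝ} (hc : 0 < c)
    (hF : IsApproxSimilarity F c) (horb : ∀ v, F v ∈ MulAction.orbit G x₀) :
    Tendsto (fun r : ℝ => (μHE[m] (MulAction.orbit G x₀)).toReal *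
      μ.real {g : G | g • x₀ ∈ F '' box κ r} / (2 * r) ^ m) (𝓝[>] 0) (𝓝 (c ^ m)) := by
  refine (hF.tendsto_measure_image_box hc hm).congr' ?_
  filter_upwards [hF.eventually_isCompact] with r hr
  congr 1
  have hS := hr.isClosed.measurableSet
  have h := congrArg (fun ν : Measure Y => ν (F '' box κ r))
    (euclideanHausdorffMeasure_restrict_orbit μ m x₀ hfin)
  simp only [Measure.smul_apply, smul_eq_mul] at h
  rw [Measure.restrict_apply hS, Measure.map_apply (f := fun g : G => g • x₀)
    (continuous_id.smul continuous_const).measurable hS, inter_eq_left.2] at h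
  · rw [h, ENNReal.toReal_mul]; rfl
  · rintro _ ⟨v, -, rfl⟩; exact horb v

end Invariant

/-! ### Finiteness of the measure of an orbit -/

/-- A level set of a strictly differentiable map `Ψ` has locally finite `m`-dimensional measure if
some linear map `π` to `ℝ^m` is injective on the kernel of the derivative `L`: near the point, `π`
shrinks distances on the level set by at most a constant factor. -/
theorem exists_nhds_levelSet_measure_lt_top {Y Z : Type*} [NormedAddCommGroup Y] [NormedSpace ℝ Y]
    [FiniteDimensional ℝ Y] [MeasurableSpace Y] [BorelSpace Y] [NormedAddCommGroup Z]
    [NormedSpace ℝ Z] {Ψ : Y → Z} {L : Y →L[ℝ] Z} {y₀ : Y} (hΨ : HasStrictFDerivAt Ψ L y₀)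
    {κ : Type*} [Fintype κ] {m : ℕ} (hm : Fintype.card κ = m) (π : Y →L[ℝ] EuclideanSpace ℝ κ)
    (hπ : ∀ y, π y = 0 → L y = 0 → y = 0) :
    ∃ U ∈ 𝓝 y₀, μHE[m] (U ∩ {y | Ψ y = Ψ y₀}) < ∞ := by
  obtain ⟨K, hK, hanti⟩ := (π.prod L).toLinearMap.exists_antilipschitzWith
    (LinearMap.ker_eq_bot'.2 fun y hy => hπ y (congrArg Prod.fst hy) (congrArg Prod.snd hy))
  have hbound : ∀ y : Y, ‖y‖ ≤ K * max ‖π y‖ ‖L y‖ := fun y => by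
    simpa [dist_eq_norm, Prod.norm_def] using hanti.le_mul_dist y 0
  have hK0 : (0 : ℝ) < K := hK
  have h := hΨ.isLittleO.def (show (0 : ℝ) < (2 * K)⁻¹ by positivity)
  rw [nhds_prod_eq] at h
  obtain ⟨U, hU, H⟩ := eventually_prod_self_iff
    (r := fun x y => ‖Ψ x - Ψ y - L (x - y)‖ ≤ (2 * (K : ℝ))⁻¹ * ‖x - y‖) |>.1 h
  refine ⟨U ∩ Metric.ball y₀ 1, inter_mem hU (Metric.ball_mem_nhds _ one_pos), ?_⟩
  set S := U ∩ Metric.ball y₀ 1 ∩ {y | Ψ y = Ψ y₀} with hS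
  have hcontr : ∀ x ∈ S, ∀ y ∈ S, dist x y ≤ K * dist (π x) (π y) := by
    rintro x ⟨⟨hx, -⟩, hx' : Ψ x = Ψ y₀⟩ y ⟨⟨hy, -⟩, hy' : Ψ y = Ψ y₀⟩
    have h1 := H x hx y hy
    rw [hx', hy', sub_self, zero_sub, norm_neg] at h1
    rw [dist_eq_norm, dist_eq_norm, ← map_sub]
    have h2 := hbound (x - y)
    rcases max_cases ‖π (x - y)‖ ‖L (x - y)‖ with ⟨h3, -⟩ | ⟨h3, -⟩
    · rwa [h3] at h2
    · rw [h3] at h2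
      have h4 : K * ‖L (x - y)‖ ≤ ‖x - y‖ / 2 := by
        calc K * ‖L (x - y)‖ ≤ K * ((2 * (K : ℝ))⁻¹ * ‖x - y‖) := by gcongr
          _ = ‖x - y‖ / 2 := by field_simp
      have h5 : ‖x - y‖ ≤ 0 := by linarith [norm_nonneg (x - y)]
      exact h5.trans (by positivity)
  refine (le_euclideanHausdorffMeasure_image hcontr m).trans_lt ?_
  have hbdd : Bornology.IsBounded (π '' S) :=
    π.lipschitz.isBounded_image (Metric.isBounded_ball.subset fun y hy => hy.1.2)
  rw [euclideanHausdorffMeasure_eq_volume_of_card hm]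
  exact ENNReal.mul_lt_top (by simp) hbdd.measure_lt_top

/-- The measure of an orbit is finite if that of a small piece of it is. -/
theorem measure_orbit_ne_top {G Y : Type*} [Group G] [TopologicalSpace G] [CompactSpace G]
    [MetricSpace Y] [MeasurableSpace Y] [BorelSpace Y] [MulAction G Y] [ContinuousSMul G Y]
    [IsIsometricSMul G Y] (m : ℕ) {x₀ : Y}
    (h : ∃ U ∈ 𝓝 x₀, μHE[m] (U ∩ MulAction.orbit G x₀) < ∞) :
    μHE[m] (MulAction.orbit G x₀) ≠ ∞ := by
  obtain ⟨U, hU, hfin⟩ := h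
  refine ((isCompact_orbit (G := G) x₀).measure_lt_top_of_nhdsWithin fun x hx => ?_).ne
  obtain ⟨g, rfl⟩ := hx
  refine ⟨(g⁻¹ • ·) ⁻¹' U ∩ MulAction.orbit G x₀, inter_mem (mem_nhdsWithin_of_mem_nhds ?_)
    self_mem_nhdsWithin, ?_⟩
  · refine (continuous_const_smul g⁻¹).continuousAt.preimage_mem_nhds ?_
    simpa using hU
  · have hp := (isometry_smul Y g).euclideanHausdorffMeasure_image (d := m)
      (U ∩ MulAction.orbit G x₀)
    rw [← hp] at hfin
    refine lt_of_le_of_lt (measure_mono ?_) hfin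
    rintro y ⟨hy, hy'⟩
    exact ⟨g⁻¹ • y, ⟨hy, MulAction.mem_orbit_of_mem_orbit _ hy'⟩, by simp⟩

/-! ### The Frobenius distance and the actions of the orthogonal group -/

theorem norm_matrixPoint_sq {n : ℕ} (A : Matrix (Fin n) (Fin n) ℝ) :
    ‖matrixPoint A‖ ^ 2 = (A.transpose * A).trace := by
  rw [EuclideanSpace.norm_sq_eq, Fintype.sum_prod_type_right]
  simp [matrixPoint, Matrix.trace, Matrix.mul_apply, pow_two]

/-- `matrixPoint` as a linear equivalence. -/
def matrixPointEquiv (n : ℕ) :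
    Matrix (Fin n) (Fin n) ℝ ≃ₗ[ℝ] EuclideanSpace ℝ (Fin n × Fin n) where
  toFun := matrixPoint
  invFun x := Matrix.of fun i j => x (i, j)
  left_inv _ := rfl
  right_inv _ := rfl
  map_add' _ _ := rfl
  map_smul' _ _ := rfl

theorem matrixPoint_injective {n : ℕ} :
    Function.Injective (matrixPoint : Matrix (Fin n) (Fin n) ℝ → _) :=
  (matrixPointEquiv n).injective

theorem continuous_matrixPoint {n : ℕ} :
    Continuous (matrixPoint : Matrix (Fin n) (Fin n) ℝ → _) := by
  refine (PiLp.continuous_toLp 2 _).comp (continuous_pi fun ij => ?_)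
  exact continuous_id.matrix_elem _ _

theorem continuous_matrixPointEquiv_symm {n : ℕ} : Continuous (matrixPointEquiv n).symm :=
  LinearMap.continuous_of_finiteDimensional (matrixPointEquiv n).symm.toLinearMap

theorem OG.transpose_mul {n : ℕ} (k : OG n) : k.1.transpose * k.1 = 1 :=
  (Matrix.mem_orthogonalGroup_iff' _ _).1 k.2

theorem OG.mul_transpose {n : ℕ} (k : OG n) : k.1 * k.1.transpose = 1 :=
  (Matrix.mem_orthogonalGroup_iff _ _).1 k.2

theorem OG.coe_inv {n : ℕ} (k : OG n) : (k⁻¹).1 = k.1.transpose := rfl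

theorem norm_matrixPoint_mul_left {n : ℕ} (k : OG n) (A : Matrix (Fin n) (Fin n) ℝ) :
    ‖matrixPoint (k.1 * A)‖ = ‖matrixPoint A‖ := by
  rw [← sq_eq_sq₀ (norm_nonneg _) (norm_nonneg _), norm_matrixPoint_sq, norm_matrixPoint_sq,
    Matrix.transpose_mul, Matrix.mul_assoc, ← Matrix.mul_assoc k.1.transpose, k.transpose_mul,
    Matrix.one_mul]

theorem norm_matrixPoint_mul_right {n : ℕ} (k : OG n) (A : Matrix (Fin n) (Fin n) ℝ) :
    ‖matrixPoint (A * k.1)‖ = ‖matrixPoint A‖ := by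
  rw [← sq_eq_sq₀ (norm_nonneg _) (norm_nonneg _), norm_matrixPoint_sq, norm_matrixPoint_sq,
    Matrix.transpose_mul, Matrix.trace_mul_comm, Matrix.mul_assoc, ← Matrix.mul_assoc k.1,
    k.mul_transpose, Matrix.one_mul, Matrix.trace_mul_comm]

instance OG.instSecondCountableTopology {n : ℕ} : SecondCountableTopology (OG n) := by
  have : SecondCountableTopology (Matrix (Fin n) (Fin n) ℝ) :=
    inferInstanceAs (SecondCountableTopology (Fin n → Fin n → ℝ))
  exact TopologicalSpace.Subtype.secondCountableTopology _

/-- `O(n)` acts on the space of matrices by multiplication from the left. -/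
instance OG.instSMulMatrixPoint {n : ℕ} : SMul (OG n) (EuclideanSpace ℝ (Fin n × Fin n)) where
  smul k x := matrixPoint (k.1 * (matrixPointEquiv n).symm x)

instance OG.instMulActionMatrixPoint {n : ℕ} :
    MulAction (OG n) (EuclideanSpace ℝ (Fin n × Fin n)) where
  one_smul x := by
    change matrixPoint ((1 : Matrix (Fin n) (Fin n) ℝ) * (matrixPointEquiv n).symm x) = x
    rw [Matrix.one_mul]; rfl
  mul_smul k l x := by
    change matrixPoint (k.1 * l.1 * (matrixPointEquiv n).symm x) =
      matrixPoint (k.1 * (l.1 * (matrixPointEquiv n).symm x))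
    rw [Matrix.mul_assoc]

instance OG.instContinuousSMulMatrixPoint {n : ℕ} :
    ContinuousSMul (OG n) (EuclideanSpace ℝ (Fin n × Fin n)) :=
  ⟨continuous_matrixPoint.comp ((continuous_subtype_val.comp continuous_fst).matrix_mul
    (continuous_matrixPointEquiv_symm.comp continuous_snd))⟩

instance OG.instIsIsometricSMulMatrixPoint {n : ℕ} :
    IsIsometricSMul (OG n) (EuclideanSpace ℝ (Fin n × Fin n)) :=
  ⟨fun k => Isometry.of_dist_eq fun x y => by
    obtain ⟨A, rfl⟩ := (matrixPointEquiv n).surjective x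
    obtain ⟨B, rfl⟩ := (matrixPointEquiv n).surjective y
    change dist (matrixPointEquiv n (k.1 * A)) (matrixPointEquiv n (k.1 * B)) = _
    rw [dist_eq_norm, dist_eq_norm, ← map_sub, ← map_sub, ← mul_sub]
    exact norm_matrixPoint_mul_left k _⟩

theorem OG.smul_def {n : ℕ} (k : OG n) (x : E n) : k • x = Matrix.toEuclideanLin k.1 x := rfl

theorem OG.smul_eq_toLp {n : ℕ} (k : OG n) (x : E n) :
    k • x = WithLp.toLp 2 (k.1.mulVec (WithLp.ofLp x)) := rfl

theorem OG.inner_smul_smul {n : ℕ} (k : OG n) (x y : E n) :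
    inner ℝ (k • x) (k • y) = inner ℝ x y := by
  rw [OG.smul_eq_toLp, OG.smul_eq_toLp, EuclideanSpace.inner_eq_star_dotProduct,
    EuclideanSpace.inner_eq_star_dotProduct]
  simp only [star_trivial]
  rw [Matrix.dotProduct_mulVec, Matrix.vecMul_mulVec, k.transpose_mul, Matrix.vecMul_one]

theorem OG.norm_smul {n : ℕ} (k : OG n) (x : E n) : ‖k • x‖ = ‖x‖ := by
  rw [← sq_eq_sq₀ (norm_nonneg _) (norm_nonneg _), ← real_inner_self_eq_norm_sq,
    ← real_inner_self_eq_norm_sq, OG.inner_smul_smul]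

/-- The action of an orthogonal matrix as a linear isometry. -/
def OG.toIsometryEquiv {n : ℕ} (k : OG n) : E n ≃ₗᵢ[ℝ] E n where
  toLinearEquiv := OG.toEquiv k
  norm_map' := OG.norm_smul k

instance OG.instContinuousSMulE {n : ℕ} : ContinuousSMul (OG n) (E n) :=
  ⟨(PiLp.continuous_toLp 2 _).comp ((continuous_subtype_val.comp continuous_fst).matrix_mulVec
    ((PiLp.continuous_ofLp 2 _).comp continuous_snd))⟩

instance OG.instIsIsometricSMulE {n : ℕ} : IsIsometricSMul (OG n) (E n) :=
  ⟨fun k => k.toIsometryEquiv.isometry⟩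

/-- A shortcut for instance search. -/
instance Gr.instSMul {d n : ℕ} : SMul (OG n) (Gr d n) := Gr.instMulAction.toSMul

theorem Gr.smul_space {d n : ℕ} (k : OG n) (σ : Gr d n) :
    (k • σ).space = σ.space.map (Matrix.toEuclideanLin k.1) := rfl

theorem Gr.mem_smul_space {d n : ℕ} (k : OG n) (σ : Gr d n) (x : E n) :
    x ∈ (k • σ).space ↔ k⁻¹ • x ∈ σ.space := by
  rw [Gr.smul_space, Submodule.mem_map]
  constructor
  · rintro ⟨y, hy, rfl⟩
    rw [← OG.smul_def, inv_smul_smul]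
    exact hy
  · exact fun h => ⟨_, h, smul_inv_smul k x⟩

theorem Gr.starProjection_smul {d n : ℕ} (k : OG n) (σ : Gr d n) (x : E n) :
    (k • σ).space.starProjection (k • x) = k • σ.space.starProjection x := by
  refine Submodule.eq_starProjection_of_mem_of_inner_eq_zero ?_ ?_
  · rw [Gr.mem_smul_space, inv_smul_smul]
    exact Submodule.starProjection_apply_mem _ _
  · intro w hw
    rw [Gr.mem_smul_space] at hw
    have : k • x - k • σ.space.starProjection x = k • (x - σ.space.starProjection x) :=
      (map_sub k.toIsometryEquiv _ _).symm
    rw [this, ← smul_inv_smul k w, OG.inner_smul_smul]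
    exact Submodule.starProjection_inner_eq_zero _ _ hw

theorem Gr.projMatrix_mulVec {d n : ℕ} (σ : Gr d n) (x : E n) :
    Matrix.toEuclideanLin σ.projMatrix x = σ.space.starProjection x := by
  have : Matrix.toEuclideanLin σ.projMatrix = σ.space.starProjection.toLinearMap := by
    refine (EuclideanSpace.basisFun (Fin n) ℝ).toBasis.ext fun j => ?_
    ext i
    simp [Gr.projMatrix]
  rw [this]; rfl

theorem Gr.projMatrix_smul {d n : ℕ} (k : OG n) (σ : Gr d n) :
    (k • σ).projMatrix = k.1 * σ.projMatrix * k.1.transpose := by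
  apply Matrix.toEuclideanLin.injective
  ext1 x
  rw [Gr.projMatrix_mulVec]
  conv_lhs => rw [← smul_inv_smul k x, Gr.starProjection_smul, ← Gr.projMatrix_mulVec]
  simp only [OG.smul_def, OG.coe_inv]
  rw [show Matrix.toEuclideanLin (k.1 * σ.projMatrix * k.1.transpose) =
    Matrix.toEuclideanLin k.1 ∘ₗ Matrix.toEuclideanLin σ.projMatrix ∘ₗ
      Matrix.toEuclideanLin k.1.transpose by
    rw [Matrix.mul_assoc]
    exact (Matrix.toLpLin_mul_same _ _ _).trans (congrArg _ (Matrix.toLpLin_mul_same _ _ _))]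
  rfl

theorem Gr.isometry_embed {d n : ℕ} : Isometry (Gr.embed : Gr d n → _) :=
  Isometry.of_dist_eq fun _ _ => rfl

theorem Gr.continuous_projMatrix {d n : ℕ} :
    Continuous (Gr.projMatrix : Gr d n → Matrix (Fin n) (Fin n) ℝ) := by
  have h : (Gr.projMatrix : Gr d n → Matrix (Fin n) (Fin n) ℝ) =
      fun σ => (matrixPointEquiv n).symm (Real.sqrt 2 • σ.embed) := by
    funext σ
    rw [Gr.embed, smul_smul, mul_inv_cancel₀ (by positivity), one_smul]
    rfl
  rw [h]
  have h1 : Continuous (Gr.embed : Gr d n → _) := Gr.isometry_embed.continuous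
  exact continuous_matrixPointEquiv_symm.comp (by fun_prop)

instance Gr.instContinuousSMul {d n : ℕ} : ContinuousSMul (OG n) (Gr d n) := by
  refine ⟨Gr.isometry_embed.isEmbedding.isInducing.continuous_iff.2 ?_⟩
  have : (Gr.embed ∘ fun p : OG n × Gr d n => p.1 • p.2) = fun p =>
      (Real.sqrt 2)⁻¹ • matrixPoint (p.1.1 * p.2.projMatrix * p.1.1.transpose) := by
    funext p
    simp [Gr.embed, Gr.projMatrix_smul]
  rw [this]
  have h1 : Continuous fun p : OG n × Gr d n => p.1.1 := continuous_subtype_val.comp continuous_fst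
  have h2 := continuous_matrixPoint.comp ((h1.matrix_mul
    (Gr.continuous_projMatrix.comp continuous_snd)).matrix_mul h1.matrix_transpose)
  exact h2.const_smul (Real.sqrt 2)⁻¹

instance Gr.instIsIsometricSMul {d n : ℕ} : IsIsometricSMul (OG n) (Gr d n) :=
  ⟨fun k => Isometry.of_dist_eq fun σ τ => by
    change dist (Gr.embed (k • σ)) (Gr.embed (k • τ)) = dist (Gr.embed σ) (Gr.embed τ)
    simp only [Gr.embed, dist_smul₀, Gr.projMatrix_smul]
    congr 1
    change dist (matrixPointEquiv n _) (matrixPointEquiv n _) =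
      dist (matrixPointEquiv n _) (matrixPointEquiv n _)
    rw [dist_eq_norm, dist_eq_norm, ← map_sub, ← map_sub, ← sub_mul, ← mul_sub]
    exact (norm_matrixPoint_mul_right k⁻¹ _).trans (norm_matrixPoint_mul_left k _)⟩

/-- `O(n)` acts transitively on the Grassmannian. -/
theorem Gr.exists_smul_eq {d n : ℕ} (σ τ : Gr d n) : ∃ k : OG n, k • σ = τ := by
  have hfr : Module.finrank ℝ σ.space = Module.finrank ℝ τ.space := σ.2.trans τ.2.symm
  let L : σ.space ≃ₗᵢ[ℝ] τ.space := (stdOrthonormalBasis ℝ σ.space).equiv (stdOrthonormalBasis ℝ τ.space)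
    (finCongr hfr)
  let M : E n →ₗᵢ[ℝ] E n := (τ.space.subtypeₗᵢ.comp L.toLinearIsometry).extend
  have hM : ∀ x : σ.space, M x = L x := LinearIsometry.extend_apply _
  let b := EuclideanSpace.basisFun (Fin n) ℝ
  let A : Matrix (Fin n) (Fin n) ℝ := LinearMap.toMatrix b.toBasis b.toBasis M.toLinearMap
  have hk : A ∈ Matrix.orthogonalGroup (Fin n) ℝ :=
    (M.toLinearIsometryEquiv rfl).toMatrix_mem_unitaryGroup b b
  have hA : Matrix.toEuclideanLin A = M.toLinearMap := by
    rw [Matrix.toEuclideanLin_eq_toLin_orthonormal]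
    exact Matrix.toLin_toMatrix _ _ _
  refine ⟨⟨A, hk⟩, Subtype.ext ?_⟩
  change σ.space.map (Matrix.toEuclideanLin A) = τ.space
  rw [hA]
  apply le_antisymm
  · rintro _ ⟨x, hx, rfl⟩
    change M x ∈ _
    rw [hM ⟨x, hx⟩]
    exact (L _).2
  · intro y hy
    refine ⟨L.symm ⟨y, hy⟩, (L.symm ⟨y, hy⟩).2, ?_⟩
    change M (L.symm ⟨y, hy⟩) = y
    rw [hM]
    simp

instance Gr.instIsPretransitive {d n : ℕ} : MulAction.IsPretransitive (OG n) (Gr d n) :=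
  ⟨Gr.exists_smul_eq⟩

/-! ### Block matrices -/

/-- The matrix with blocks `A B C D`, its index type flattened. -/
def blk {e d : ℕ} (A : Matrix (Fin e) (Fin e) ℝ) (B : Matrix (Fin e) (Fin d) ℝ)
    (C : Matrix (Fin d) (Fin e) ℝ) (D : Matrix (Fin d) (Fin d) ℝ) :
    Matrix (Fin (e + d)) (Fin (e + d)) ℝ :=
  (Matrix.fromBlocks A B C D).submatrix finSumFinEquiv.symm finSumFinEquiv.symm

section blk
variable {e d : ℕ} (A A' : Matrix (Fin e) (Fin e) ℝ) (B B' : Matrix (Fin e) (Fin d) ℝ)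
    (C C' : Matrix (Fin d) (Fin e) ℝ) (D D' : Matrix (Fin d) (Fin d) ℝ)

theorem blk_mul : blk A B C D * blk A' B' C' D' =
    blk (A * A' + B * C') (A * B' + B * D') (C * A' + D * C') (C * B' + D * D') := by
  rw [blk, blk, blk, Matrix.submatrix_mul_equiv, Matrix.fromBlocks_multiply]

theorem blk_transpose : (blk A B C D).transpose =
    blk A.transpose C.transpose B.transpose D.transpose := by
  rw [blk, blk, Matrix.transpose_submatrix, Matrix.fromBlocks_transpose]

theorem blk_one : blk (1 : Matrix (Fin e) (Fin e) ℝ) 0 0 (1 : Matrix (Fin d) (Fin d) ℝ) = 1 := by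
  rw [blk, Matrix.fromBlocks_one, Matrix.submatrix_one_equiv]

theorem blk_add : blk A B C D + blk A' B' C' D' = blk (A + A') (B + B') (C + C') (D + D') := by
  rw [blk, blk, blk, ← Matrix.fromBlocks_add]; rfl

theorem blk_smul (c : ℝ) : c • blk A B C D = blk (c • A) (c • B) (c • C) (c • D) := by
  rw [blk, blk, ← Matrix.fromBlocks_smul]; rfl

theorem blk_sub : blk A B C D - blk A' B' C' D' = blk (A - A') (B - B') (C - C') (D - D') := by
  rw [sub_eq_add_neg, ← neg_one_smul ℝ (blk A' B' C' D'), blk_smul, blk_add]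
  simp [sub_eq_add_neg]

theorem blk_inj {A A' : Matrix (Fin e) (Fin e) ℝ} {B B' : Matrix (Fin e) (Fin d) ℝ}
    {C C' : Matrix (Fin d) (Fin e) ℝ} {D D' : Matrix (Fin d) (Fin d) ℝ} :
    blk A B C D = blk A' B' C' D' ↔ A = A' ∧ B = B' ∧ C = C' ∧ D = D' := by
  rw [← Matrix.fromBlocks_inj]
  refine ⟨fun h => ?_, fun h => by rw [blk, blk, h]⟩
  have := congrArg (fun M => M.submatrix (finSumFinEquiv (m := e) (n := d)) finSumFinEquiv) h
  simpa [blk] using this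

theorem exists_eq_blk (M : Matrix (Fin (e + d)) (Fin (e + d)) ℝ) :
    ∃ A B C D, M = blk (e := e) (d := d) A B C D := by
  let N := M.submatrix (finSumFinEquiv (m := e) (n := d)) finSumFinEquiv
  refine ⟨N.toBlocks₁₁, N.toBlocks₁₂, N.toBlocks₂₁, N.toBlocks₂₂, ?_⟩
  rw [blk, Matrix.fromBlocks_toBlocks]
  ext i j
  simp [N]

theorem norm_matrixPoint_sq_eq_sum {n : ℕ} (M : Matrix (Fin n) (Fin n) ℝ) :
    ‖matrixPoint M‖ ^ 2 = ∑ i, ∑ j, M i j ^ 2 := by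
  rw [EuclideanSpace.norm_sq_eq, Fintype.sum_prod_type]
  simp [matrixPoint]

theorem norm_matrixPoint_blk_sq : ‖matrixPoint (blk A B C D)‖ ^ 2 =
    (∑ i, ∑ j, A i j ^ 2) + (∑ i, ∑ j, B i j ^ 2) + (∑ i, ∑ j, C i j ^ 2) +
      ∑ i, ∑ j, D i j ^ 2 := by
  rw [norm_matrixPoint_sq_eq_sum]
  simp only [Fin.sum_univ_add, blk, Matrix.submatrix_apply, finSumFinEquiv_symm_apply_castAdd,
    finSumFinEquiv_symm_apply_natAdd, Matrix.fromBlocks_apply₁₁, Matrix.fromBlocks_apply₁₂,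
    Matrix.fromBlocks_apply₂₁, Matrix.fromBlocks_apply₂₂, Finset.sum_add_distrib]
  ring

end blk

/-! ### Coordinates on the Lie algebra of the orthogonal group -/

/-- The index set of the entries above the diagonal. -/
abbrev UpperIdx (n : ℕ) : Type := {p : Fin n × Fin n // p.1 < p.2}

theorem card_upperIdx (n : ℕ) : Fintype.card (UpperIdx n) = n * (n - 1) / 2 := by
  have h1 : Fintype.card (UpperIdx n) =
      ∑ i : Fin n, (Finset.univ.filter fun j : Fin n => i < j).card := by
    rw [Fintype.card_subtype, Finset.card_filter, Fintype.sum_prod_type]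
    exact Finset.sum_congr rfl fun i _ => (Finset.card_filter _ _).symm
  have h2 : ∀ i : Fin n, (Finset.univ.filter fun j : Fin n => i < j).card = n - 1 - i := fun i => by
    rw [show (Finset.univ.filter fun j : Fin n => i < j) = Finset.Ioi i by ext; simp, Fin.card_Ioi]
  simp only [h1, h2]
  rw [Fin.sum_univ_eq_sum_range (fun i => n - 1 - i), Finset.sum_range_reflect (fun i => i),
    Finset.sum_range_id]

/-- The strictly upper triangular matrix with given entries. -/
def upperMatrix (n : ℕ) : EuclideanSpace ℝ (UpperIdx n) →ₗ[ℝ] Matrix (Fin n) (Fin n) ℝ where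
  toFun a := Matrix.of fun i j => if h : i < j then a ⟨(i, j), h⟩ else 0
  map_add' a b := by ext i j; by_cases h : i < j <;> simp [h]
  map_smul' c a := by ext i j; by_cases h : i < j <;> simp [h]

/-- The skew-symmetric matrix with given entries above the diagonal. -/
def skewMatrix (n : ℕ) : EuclideanSpace ℝ (UpperIdx n) →ₗ[ℝ] Matrix (Fin n) (Fin n) ℝ where
  toFun a := upperMatrix n a - (upperMatrix n a).transpose
  map_add' a b := by rw [map_add, Matrix.transpose_add]; abel
  map_smul' c a := by rw [map_smul, Matrix.transpose_smul, ← smul_sub]; rfl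

theorem skewMatrix_transpose {n : ℕ} (a : EuclideanSpace ℝ (UpperIdx n)) :
    (skewMatrix n a).transpose = -skewMatrix n a := by
  change (upperMatrix n a - (upperMatrix n a).transpose).transpose =
    -(upperMatrix n a - (upperMatrix n a).transpose)
  rw [Matrix.transpose_sub, Matrix.transpose_transpose, neg_sub]

theorem sum_skewMatrix_sq {n : ℕ} (a : EuclideanSpace ℝ (UpperIdx n)) :
    ∑ i, ∑ j, skewMatrix n a i j ^ 2 = 2 * ‖a‖ ^ 2 := by
  have hU : ∑ i, ∑ j, upperMatrix n a i j ^ 2 = ‖a‖ ^ 2 := by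
    rw [EuclideanSpace.norm_sq_eq, ← Fintype.sum_prod_type' (f := fun i j => upperMatrix n a i j ^ 2)]
    symm
    refine Fintype.sum_of_injective Subtype.val Subtype.val_injective _ _ ?_ ?_
    · rintro ⟨i, j⟩ h
      have : ¬ i < j := fun hij => h ⟨⟨(i, j), hij⟩, rfl⟩
      simp [upperMatrix, this]
    · rintro ⟨⟨i, j⟩, hij⟩
      have hij' : i < j := hij
      simp [upperMatrix, hij']
  have hexp : ∀ i j, skewMatrix n a i j ^ 2 =
      upperMatrix n a i j ^ 2 + upperMatrix n a j i ^ 2 := fun i j => by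
    have h0 : upperMatrix n a i j * upperMatrix n a j i = 0 := by
      rcases lt_or_ge i j with h | h
      · simp [upperMatrix, h.not_gt]
      · simp [upperMatrix, h.not_gt]
    change (upperMatrix n a i j - upperMatrix n a j i) ^ 2 = _
    linear_combination (-2) * h0
  simp only [hexp, Finset.sum_add_distrib]
  rw [Finset.sum_comm (f := fun i j => upperMatrix n a j i ^ 2), hU]
  ring

/-- The skew-symmetric matrix with off-diagonal block `v`: the velocity of a rotation of the
coordinate plane `basePlane e d` towards the graph of a linear map. -/
def tiltMatrix (e d : ℕ) :
    EuclideanSpace ℝ (Fin e × Fin d) →ₗ[ℝ] Matrix (Fin (e + d)) (Fin (e + d)) ℝ where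
  toFun v := blk 0 (Matrix.of fun i j => v (i, j)) (-(Matrix.of fun i j => v (i, j)).transpose) 0
  map_add' v w := by
    rw [blk_add]
    congr 1
    · simp
    · ext i j; simp [add_comm]
    · simp
  map_smul' c v := by
    rw [RingHom.id_apply, blk_smul]
    congr 1
    · simp
    · ext i j; simp
    · simp

theorem tiltMatrix_apply {e d : ℕ} (v : EuclideanSpace ℝ (Fin e × Fin d)) :
    tiltMatrix e d v =
      blk 0 (Matrix.of fun i j => v (i, j)) (-(Matrix.of fun i j => v (i, j)).transpose) 0 := rfl

theorem tiltMatrix_transpose {e d : ℕ} (v : EuclideanSpace ℝ (Fin e × Fin d)) :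
    (tiltMatrix e d v).transpose = -tiltMatrix e d v := by
  rw [tiltMatrix_apply, blk_transpose, ← neg_one_smul ℝ (blk _ _ _ _), blk_smul]
  simp

theorem exp_mem_orthogonalGroup {n : ℕ} {A : Matrix (Fin n) (Fin n) ℝ} (hA : A.transpose = -A) :
    NormedSpace.exp A ∈ Matrix.orthogonalGroup (Fin n) ℝ := by
  rw [Matrix.mem_orthogonalGroup_iff', ← Matrix.exp_transpose, hA, Matrix.exp_neg]
  exact Matrix.nonsing_inv_mul _ ((Matrix.isUnit_iff_isUnit_det _).1 (Matrix.isUnit_exp A))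

/-- Exponential coordinates on the orthogonal group. -/
def expSkew {n : ℕ} (a : EuclideanSpace ℝ (UpperIdx n)) : OG n :=
  ⟨NormedSpace.exp (skewMatrix n a), exp_mem_orthogonalGroup (skewMatrix_transpose a)⟩

/-- The rotation generated by `tiltMatrix`. -/
def expTilt {e d : ℕ} (v : EuclideanSpace ℝ (Fin e × Fin d)) : OG (e + d) :=
  ⟨NormedSpace.exp (tiltMatrix e d v), exp_mem_orthogonalGroup (tiltMatrix_transpose v)⟩

/-- The inclusion of `O(e) × O(d)` in `O(e + d)`, as block diagonal matrices. -/
def blockHom (e d : ℕ) : OG e × OG d →* OG (e + d) where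
  toFun h := ⟨blk h.1.1 0 0 h.2.1, by
    rw [Matrix.mem_orthogonalGroup_iff', blk_transpose, blk_mul]
    simp [h.1.transpose_mul, h.2.transpose_mul, blk_one]⟩
  map_one' := Subtype.ext blk_one
  map_mul' h h' := Subtype.ext <| by
    change blk (h.1.1 * h'.1.1) 0 0 (h.2.1 * h'.2.1) = blk _ _ _ _ * blk _ _ _ _
    rw [blk_mul]
    simp

theorem coe_blockHom {e d : ℕ} (h : OG e × OG d) : (blockHom e d h).1 = blk h.1.1 0 0 h.2.1 := rfl

theorem blockHom_injective (e d : ℕ) : Function.Injective (blockHom e d) := by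
  intro h h' hh
  have := blk_inj.1 (congrArg Subtype.val hh)
  exact Prod.ext (Subtype.ext this.1) (Subtype.ext this.2.2.2)

theorem continuous_blockHom (e d : ℕ) : Continuous (blockHom e d) := by
  refine Continuous.subtype_mk ?_ _
  exact ((continuous_subtype_val.comp continuous_fst).matrix_fromBlocks continuous_const
    continuous_const (continuous_subtype_val.comp continuous_snd)).matrix_submatrix _ _

/-- The coordinate plane spanned by the last `d` basis vectors. -/
def basePlane (e d : ℕ) : Gr d (e + d) :=
  ⟨Submodule.span ℝ (range fun i : Fin d => EuclideanSpace.single (Fin.natAdd e i) (1 : ℝ)), by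
    have h : LinearIndependent ℝ
        fun i : Fin d => (EuclideanSpace.single (Fin.natAdd e i) (1 : ℝ) : E (e + d)) := by
      have := (EuclideanSpace.basisFun (Fin (e + d)) ℝ).orthonormal.linearIndependent.comp _
        (Fin.natAdd_injective d e)
      have he : (fun i : Fin d => (EuclideanSpace.single (Fin.natAdd e i) (1 : ℝ) : E (e + d))) =
          EuclideanSpace.basisFun (Fin (e + d)) ℝ ∘ Fin.natAdd e := by
        funext i; simp
      rw [he]
      exact this
    rw [finrank_span_eq_card h, Fintype.card_fin]⟩

theorem projMatrix_basePlane (e d : ℕ) : (basePlane e d).projMatrix = blk 0 0 0 1 := by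
  have hmem : ∀ j : Fin d, EuclideanSpace.single (Fin.natAdd e j) (1 : ℝ) ∈
      (basePlane e d).space := fun j => Submodule.subset_span ⟨j, rfl⟩
  have hperp : ∀ j : Fin e, EuclideanSpace.single (Fin.castAdd d j) (1 : ℝ) ∈
      (basePlane e d).spaceᗮ := fun j => by
    rw [Submodule.mem_orthogonal]
    intro u hu
    refine Submodule.span_induction (p := fun u _ => inner ℝ u _ = 0) ?_ ?_ ?_ ?_ hu
    · rintro _ ⟨i, rfl⟩
      simp [EuclideanSpace.inner_single_left, Fin.ext_iff]
      intro h; omega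
    · simp
    · intro x y _ _ hx hy; rw [inner_add_left, hx, hy, add_zero]
    · intro c x _ hx; rw [inner_smul_left, hx, mul_zero]
  ext i j
  refine Fin.addCases (fun j => ?_) (fun j => ?_) j
  · rw [Gr.projMatrix, Matrix.of_apply,
      Submodule.starProjection_apply_eq_zero_iff _ |>.2 (hperp j)]
    refine Fin.addCases (fun i => ?_) (fun i => ?_) i <;> simp [blk]
  · rw [Gr.projMatrix, Matrix.of_apply, Submodule.starProjection_eq_self_iff.2 (hmem j)]
    refine Fin.addCases (fun i => ?_) (fun i => ?_) i
    · simp [blk, Fin.ext_iff]; intro h; omega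
    · simp [blk, Matrix.one_apply, eq_comm, Fin.ext_iff]

theorem smul_basePlane_eq_iff {e d : ℕ} (g : OG (e + d)) :
    g • basePlane e d = basePlane e d ↔ g ∈ Set.range (blockHom e d) := by
  have h1 : g • basePlane e d = basePlane e d ↔ g.1 * blk 0 0 0 1 = blk 0 0 0 1 * g.1 := by
    rw [← Gr.projMatrix_injective.eq_iff, Gr.projMatrix_smul, projMatrix_basePlane]
    constructor
    · intro h
      have := congrArg (· * g.1) h
      simpa [Matrix.mul_assoc, g.transpose_mul] using this
    · intro h
      rw [h, Matrix.mul_assoc, g.mul_transpose, Matrix.mul_one]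
  rw [h1]
  constructor
  · intro h
    obtain ⟨A, B, C, D, hg⟩ := exists_eq_blk g.1
    rw [hg, blk_mul, blk_mul, blk_inj] at h
    simp at h
    obtain ⟨rfl, rfl⟩ := h
    have ho := g.transpose_mul
    rw [hg, blk_transpose, blk_mul, ← blk_one, blk_inj] at ho
    simp at ho
    exact ⟨(⟨A, (Matrix.mem_orthogonalGroup_iff' _ _).2 ho.1⟩,
      ⟨D, (Matrix.mem_orthogonalGroup_iff' _ _).2 ho.2⟩), Subtype.ext hg.symm⟩
  · rintro ⟨h, rfl⟩
    rw [coe_blockHom, blk_mul, blk_mul]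
    simp

/-! ### Derivatives of the parametrizations -/

section Frobenius
open scoped Matrix.Norms.Frobenius

theorem hasStrictFDerivAt_matrixPoint_exp {n : ℕ} :
    HasStrictFDerivAt (fun x : EuclideanSpace ℝ (Fin n × Fin n) =>
      matrixPoint (NormedSpace.exp ((matrixPointEquiv n).symm x)))
      (ContinuousLinearMap.id ℝ _) 0 := by
  have h1 : HasStrictFDerivAt (NormedSpace.exp : Matrix (Fin n) (Fin n) ℝ → _)
      (1 : Matrix (Fin n) (Fin n) ℝ →L[ℝ] Matrix (Fin n) (Fin n) ℝ) 0 := hasStrictFDerivAt_exp_zero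
  have h2 := (matrixPointEquiv n).toContinuousLinearEquiv.symm.hasStrictFDerivAt (x := 0)
  have h3 := (matrixPointEquiv n).toContinuousLinearEquiv.hasStrictFDerivAt
    (x := NormedSpace.exp (0 : Matrix (Fin n) (Fin n) ℝ))
  have h4 := h3.comp (0 : Matrix (Fin n) (Fin n) ℝ) h1
  rw [← map_zero (matrixPointEquiv n).toContinuousLinearEquiv.symm] at h4
  have h5 := h4.comp 0 h2
  exact h5.congr_fderiv (by ext1 x; rfl)
end Frobenius

/-- The matrix-valued map `f` is strictly differentiable at `x`, with derivative `f'`. -/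
def HasMatrixDerivAt {V : Type*} [NormedAddCommGroup V] [NormedSpace ℝ V] [FiniteDimensional ℝ V]
    {n : ℕ} (f : V → Matrix (Fin n) (Fin n) ℝ) (f' : V →ₗ[ℝ] Matrix (Fin n) (Fin n) ℝ) (x : V) :
    Prop :=
  HasStrictFDerivAt (fun v => matrixPoint (f v))
    ((matrixPointEquiv n).toLinearMap ∘ₗ f').toContinuousLinearMap x

/-- Matrix multiplication as a bilinear map on `EuclideanSpace ℝ (Fin n × Fin n)`. -/
def matrixMulBilin (n : ℕ) : EuclideanSpace ℝ (Fin n × Fin n) →L[ℝ]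
    EuclideanSpace ℝ (Fin n × Fin n) →L[ℝ] EuclideanSpace ℝ (Fin n × Fin n) :=
  (LinearMap.toContinuousLinearMap.toLinearMap ∘ₗ LinearMap.mk₂ ℝ
    (fun x y => matrixPointEquiv n ((matrixPointEquiv n).symm x * (matrixPointEquiv n).symm y))
    (fun x y z => by simp [add_mul]) (fun c x y => by simp)
    (fun x y z => by simp [mul_add]) (fun c x y => by simp)).toContinuousLinearMap

namespace HasMatrixDerivAt

variable {V : Type*} [NormedAddCommGroup V] [NormedSpace ℝ V] [FiniteDimensional ℝ V] {n : ℕ}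
  {f g : V → Matrix (Fin n) (Fin n) ℝ} {f' g' : V →ₗ[ℝ] Matrix (Fin n) (Fin n) ℝ} {x : V}

theorem mul (hf : HasMatrixDerivAt f f' x) (hg : HasMatrixDerivAt g g' x) :
    HasMatrixDerivAt (fun v => f v * g v)
      (LinearMap.mulRight ℝ (g x) ∘ₗ f' + LinearMap.mulLeft ℝ (f x) ∘ₗ g') x := by
  have h := (matrixMulBilin n).hasStrictFDerivAt_of_bilinear hf hg
  refine HasStrictFDerivAt.congr_fderiv h (ContinuousLinearMap.ext fun v => Eq.symm ?_)
  change matrixPoint (f' v * g x + f x * g' v) =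
    matrixPoint (f x * g' v) + matrixPoint (f' v * g x)
  rw [add_comm]; rfl

theorem linearMap_comp {m : ℕ} (T : Matrix (Fin n) (Fin n) ℝ →ₗ[ℝ] Matrix (Fin m) (Fin m) ℝ)
    (hf : HasMatrixDerivAt f f' x) : HasMatrixDerivAt (fun v => T (f v)) (T ∘ₗ f') x := by
  have h := ((matrixPointEquiv m).toLinearMap ∘ₗ T ∘ₗ
    (matrixPointEquiv n).symm.toLinearMap).toContinuousLinearMap.hasStrictFDerivAt
      (x := matrixPoint (f x))
  exact h.comp x hf

theorem exp (A : V →ₗ[ℝ] Matrix (Fin n) (Fin n) ℝ) :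
    HasMatrixDerivAt (fun v => NormedSpace.exp (A v)) A 0 := by
  have h := hasStrictFDerivAt_matrixPoint_exp (n := n)
  have h2 := ((matrixPointEquiv n).toLinearMap ∘ₗ A).toContinuousLinearMap.hasStrictFDerivAt
    (x := 0)
  rw [← map_zero ((matrixPointEquiv n).toLinearMap ∘ₗ A).toContinuousLinearMap] at h
  exact h.comp 0 h2

theorem add (hf : HasMatrixDerivAt f f' x) (hg : HasMatrixDerivAt g g' x) :
    HasMatrixDerivAt (fun v => f v + g v) (f' + g') x :=
  HasStrictFDerivAt.add hf hg

theorem linearMap (A : V →ₗ[ℝ] Matrix (Fin n) (Fin n) ℝ) : HasMatrixDerivAt (fun v => A v) A x :=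
  ((matrixPointEquiv n).toLinearMap ∘ₗ A).toContinuousLinearMap.hasStrictFDerivAt

theorem const (A : Matrix (Fin n) (Fin n) ℝ) : HasMatrixDerivAt (fun _ : V => A) 0 x := by
  exact (hasStrictFDerivAt_const (𝕜 := ℝ) (matrixPoint A) x).congr_fderiv (by ext1 v; rfl)

theorem congr_deriv (hf : HasMatrixDerivAt f f' x) (h : ∀ v, f' v = g' v) :
    HasMatrixDerivAt f g' x := by
  rwa [← LinearMap.ext h]

theorem isApproxSimilarity {f : V → Matrix (Fin n) (Fin n) ℝ} (hf : HasMatrixDerivAt f f' 0) {c : ℝ}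
    (hc : 0 ≤ c) (h : ∀ v, ‖matrixPoint (f' v)‖ ^ 2 = c ^ 2 * ‖v‖ ^ 2) :
    IsApproxSimilarity (fun v => matrixPoint (f v)) c := by
  refine HasStrictFDerivAt.isApproxSimilarity hf fun v => ?_
  rw [← sq_eq_sq₀ (norm_nonneg _) (by positivity), mul_pow]
  exact h v

end HasMatrixDerivAt

/-- The coordinates with index in the first summand. -/
def coordL (α β : Type*) [Fintype α] [Fintype β] :
    EuclideanSpace ℝ (α ⊕ β) →ₗ[ℝ] EuclideanSpace ℝ α where
  toFun x := WithLp.toLp 2 fun i => x (Sum.inl i)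
  map_add' _ _ := rfl
  map_smul' _ _ := rfl

/-- The coordinates with index in the second summand. -/
def coordR (α β : Type*) [Fintype α] [Fintype β] :
    EuclideanSpace ℝ (α ⊕ β) →ₗ[ℝ] EuclideanSpace ℝ β where
  toFun x := WithLp.toLp 2 fun i => x (Sum.inr i)
  map_add' _ _ := rfl
  map_smul' _ _ := rfl

theorem norm_sq_eq_coordL_add_coordR {α β : Type*} [Fintype α] [Fintype β]
    (x : EuclideanSpace ℝ (α ⊕ β)) :
    ‖x‖ ^ 2 = ‖coordL α β x‖ ^ 2 + ‖coordR α β x‖ ^ 2 := by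
  simp only [EuclideanSpace.norm_sq_eq, Fintype.sum_sum_type]
  rfl

theorem image2_coord_box {α β Z : Type*} [Fintype α] [Fintype β]
    (f : EuclideanSpace ℝ α → EuclideanSpace ℝ β → Z) (r : ℝ) :
    (fun x => f (coordL α β x) (coordR α β x)) '' box (α ⊕ β) r =
      image2 f (box α r) (box β r) := by
  ext z
  constructor
  · rintro ⟨x, hx, rfl⟩
    exact ⟨_, fun i => hx (Sum.inl i), _, fun i => hx (Sum.inr i), rfl⟩
  · rintro ⟨a, ha, b, hb, rfl⟩
    refine ⟨WithLp.toLp 2 (Sum.elim a b), ?_, rfl⟩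
    rintro (i | i)
    · exact ha i
    · exact hb i

theorem norm_matrixPoint_skewMatrix_sq {n : ℕ} (a : EuclideanSpace ℝ (UpperIdx n)) :
    ‖matrixPoint (skewMatrix n a)‖ ^ 2 = 2 * ‖a‖ ^ 2 := by
  rw [norm_matrixPoint_sq_eq_sum, sum_skewMatrix_sq]

/-- The factor `√2` arises because each entry above the diagonal occurs twice in the Frobenius norm. -/
theorem isApproxSimilarity_expSkew (n : ℕ) :
    IsApproxSimilarity (fun a : EuclideanSpace ℝ (UpperIdx n) => matrixPoint (expSkew a).1)
      (Real.sqrt 2) :=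
  (HasMatrixDerivAt.exp (skewMatrix n)).isApproxSimilarity (by positivity) fun v => by
    rw [norm_matrixPoint_skewMatrix_sq, Real.sq_sqrt (by norm_num)]

/-- Coordinates on `O(e + d)` adapted to the fibration over the Grassmannian: `v` moves the base
point, and `h` moves along the fibre. -/
def fibrationChart (e d : ℕ) (v : EuclideanSpace ℝ (Fin e × Fin d))
    (h : EuclideanSpace ℝ (UpperIdx e ⊕ UpperIdx d)) : OG (e + d) :=
  expTilt v * blockHom e d (expSkew (coordL _ _ h), expSkew (coordR _ _ h))

/-- The inclusion of the first diagonal block, as a linear map. -/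
def blkL (e d : ℕ) : Matrix (Fin e) (Fin e) ℝ →ₗ[ℝ] Matrix (Fin (e + d)) (Fin (e + d)) ℝ where
  toFun A := blk A 0 0 0
  map_add' A B := by rw [blk_add]; simp
  map_smul' c A := by rw [RingHom.id_apply, blk_smul]; simp

/-- The inclusion of the second diagonal block, as a linear map. -/
def blkR (e d : ℕ) : Matrix (Fin d) (Fin d) ℝ →ₗ[ℝ] Matrix (Fin (e + d)) (Fin (e + d)) ℝ where
  toFun D := blk 0 0 0 D
  map_add' A B := by rw [blk_add]; simp
  map_smul' c A := by rw [RingHom.id_apply, blk_smul]; simp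

theorem sum_of_sq {e d : ℕ} (v : EuclideanSpace ℝ (Fin e × Fin d)) :
    ∑ i, ∑ j, (Matrix.of fun i j => v (i, j)) i j ^ 2 = ‖v‖ ^ 2 := by
  rw [EuclideanSpace.norm_sq_eq, Fintype.sum_prod_type]
  simp

theorem sum_transpose_of_sq {e d : ℕ} (v : EuclideanSpace ℝ (Fin e × Fin d)) :
    ∑ i, ∑ j, (Matrix.of fun i j => v (i, j)).transpose i j ^ 2 = ‖v‖ ^ 2 := by
  rw [← sum_of_sq, Finset.sum_comm]
  rfl

/-- The derivative of the chart at the origin is the skew-symmetric matrix whose blocks are the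
coordinates, so that the Frobenius norm is again stretched by `√2`. -/
theorem isApproxSimilarity_fibrationChart (e d : ℕ) :
    IsApproxSimilarity
      (fun x : EuclideanSpace ℝ ((Fin e × Fin d) ⊕ (UpperIdx e ⊕ UpperIdx d)) =>
        matrixPoint (fibrationChart e d (coordL _ _ x) (coordR _ _ x)).1) (Real.sqrt 2) := by
  let p1 := coordL (Fin e × Fin d) (UpperIdx e ⊕ UpperIdx d)
  let p2 := coordR (Fin e × Fin d) (UpperIdx e ⊕ UpperIdx d)
  let q1 := coordL (UpperIdx e) (UpperIdx d) ∘ₗ p2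
  let q2 := coordR (UpperIdx e) (UpperIdx d) ∘ₗ p2
  have h1 := HasMatrixDerivAt.exp (tiltMatrix e d ∘ₗ p1)
  have h2 := (HasMatrixDerivAt.exp (skewMatrix e ∘ₗ q1)).linearMap_comp (blkL e d)
  have h3 := (HasMatrixDerivAt.exp (skewMatrix d ∘ₗ q2)).linearMap_comp (blkR e d)
  have h4 := (h1.mul (h2.add h3)).congr_deriv (g' := tiltMatrix e d ∘ₗ p1 +
      (blkL e d ∘ₗ skewMatrix e ∘ₗ q1 + blkR e d ∘ₗ skewMatrix d ∘ₗ q2)) fun v => by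
    have hb : blkL e d 1 + blkR e d 1 = 1 := by
      rw [← blk_one]
      exact (blk_add _ _ _ _ _ _ _ _).trans (by simp)
    simp [hb]
  have key := h4.isApproxSimilarity (c := Real.sqrt 2) (by positivity) ?_
  · convert key using 2 with x
    congr 1
    change _ * _ = _ * _
    congr 1
    change blk _ _ _ _ = blk _ _ _ _ + blk _ _ _ _
    rw [blk_add]
    simp
    rfl
  · intro x
    have hx : (tiltMatrix e d ∘ₗ p1 +
        (blkL e d ∘ₗ skewMatrix e ∘ₗ q1 + blkR e d ∘ₗ skewMatrix d ∘ₗ q2)) x =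
        blk (skewMatrix e (q1 x)) (Matrix.of fun i j => p1 x (i, j))
          (-(Matrix.of fun i j => p1 x (i, j)).transpose) (skewMatrix d (q2 x)) := by
      change blk _ _ _ _ + (blk _ _ _ _ + blk _ _ _ _) = _
      rw [blk_add, blk_add]
      simp
    rw [hx, norm_matrixPoint_blk_sq, Real.sq_sqrt (by norm_num), norm_sq_eq_coordL_add_coordR,
      norm_sq_eq_coordL_add_coordR (coordR _ _ x), sum_skewMatrix_sq, sum_skewMatrix_sq, sum_of_sq]
    simp only [Matrix.neg_apply, neg_sq, sum_transpose_of_sq]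
    change 2 * ‖q1 x‖ ^ 2 + ‖p1 x‖ ^ 2 + ‖p1 x‖ ^ 2 + 2 * ‖q2 x‖ ^ 2 =
      2 * (‖p1 x‖ ^ 2 + (‖q1 x‖ ^ 2 + ‖q2 x‖ ^ 2))
    ring

/-- Near the coordinate plane, `v ↦ exp (tiltMatrix v) • basePlane` is an isometry to first order
for the metric of the Grassmannian. -/
theorem isApproxSimilarity_expTilt_smul_basePlane (e d : ℕ) :
    IsApproxSimilarity (fun v : EuclideanSpace ℝ (Fin e × Fin d) => expTilt v • basePlane e d)
      1 := by
  have h1 := HasMatrixDerivAt.exp (tiltMatrix e d)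
  have h2 := HasMatrixDerivAt.exp (-tiltMatrix e d)
  let T : Matrix (Fin (e + d)) (Fin (e + d)) ℝ →ₗ[ℝ] Matrix (Fin (e + d)) (Fin (e + d)) ℝ :=
    (Real.sqrt 2)⁻¹ • LinearMap.id
  let P : Matrix (Fin (e + d)) (Fin (e + d)) ℝ := blk 0 0 0 1
  have h3 := (((h1.mul (HasMatrixDerivAt.const P)).mul h2).linearMap_comp T).congr_deriv
    (g' := T ∘ₗ (LinearMap.mulRight ℝ P ∘ₗ tiltMatrix e d -
      LinearMap.mulLeft ℝ P ∘ₗ tiltMatrix e d)) fun v => by simp [sub_eq_add_neg]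
  have key := h3.isApproxSimilarity (c := 1) (by positivity) ?_
  · -- the metric of the Grassmannian is the one induced by `Gr.embed`
    intro ε hε
    obtain ⟨U, hU, H⟩ := key ε hε
    refine ⟨U, hU, fun x hx y hy => ?_⟩
    have hemb : ∀ v : EuclideanSpace ℝ (Fin e × Fin d), Gr.embed (expTilt v • basePlane e d) =
        matrixPoint ((Real.sqrt 2)⁻¹ • (NormedSpace.exp (tiltMatrix e d v) * blk 0 0 0 1 *
          NormedSpace.exp (-tiltMatrix e d v))) := fun v => by
      rw [Gr.embed, Gr.projMatrix_smul, projMatrix_basePlane, ← tiltMatrix_transpose,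
        Matrix.exp_transpose]
      rfl
    have := H x hx y hy
    rw [← Gr.isometry_embed.dist_eq, hemb, hemb]
    exact this
  · intro v
    rw [one_pow, one_mul]
    have hv : (T ∘ₗ (LinearMap.mulRight ℝ P ∘ₗ tiltMatrix e d -
        LinearMap.mulLeft ℝ P ∘ₗ tiltMatrix e d)) v =
        blk 0 ((Real.sqrt 2)⁻¹ • Matrix.of fun i j => v (i, j))
          ((Real.sqrt 2)⁻¹ • (Matrix.of fun i j => v (i, j)).transpose) 0 := by
      change (Real.sqrt 2)⁻¹ • (blk _ _ _ _ * blk _ _ _ _ - blk _ _ _ _ * blk _ _ _ _) = _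
      rw [blk_mul, blk_mul, blk_sub, blk_smul]
      simp
    rw [hv, norm_matrixPoint_blk_sq]
    simp only [Matrix.smul_apply, smul_eq_mul, mul_pow, ← Finset.mul_sum, sum_of_sq,
      sum_transpose_of_sq]
    simp
    ring

/-! ### The sphere -/

/-- The last basis vector. -/
def baseVector (k : ℕ) : E (k + 1) := EuclideanSpace.single (Fin.last k) 1

/-- Evaluation of a matrix at the last basis vector. -/
def lastColumn (k : ℕ) : EuclideanSpace ℝ (Fin (k + 1) × Fin (k + 1)) →ₗ[ℝ] E (k + 1) where
  toFun x := WithLp.toLp 2 fun i => x (i, Fin.last k)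
  map_add' _ _ := rfl
  map_smul' _ _ := rfl

theorem lastColumn_apply {k : ℕ} (x : EuclideanSpace ℝ (Fin (k + 1) × Fin (k + 1)))
    (i : Fin (k + 1)) : lastColumn k x i = x (i, Fin.last k) := rfl

theorem smul_baseVector {k : ℕ} (g : OG (k + 1)) :
    g • baseVector k = lastColumn k (matrixPoint g.1) := by
  rw [OG.smul_eq_toLp]
  ext i
  simp [baseVector, lastColumn_apply, matrixPoint]

theorem norm_baseVector (k : ℕ) : ‖baseVector k‖ = 1 := by simp [baseVector]

theorem lastColumn_blk {k : ℕ} (A : Matrix (Fin k) (Fin k) ℝ) (B : Matrix (Fin k) (Fin 1) ℝ)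
    (C : Matrix (Fin 1) (Fin k) ℝ) (D : Matrix (Fin 1) (Fin 1) ℝ) :
    ‖lastColumn k (matrixPoint (blk A B C D))‖ ^ 2 = (∑ i, ∑ j, B i j ^ 2) + D 0 0 ^ 2 := by
  have hl : Fin.last k = Fin.natAdd k (0 : Fin 1) := rfl
  rw [EuclideanSpace.norm_sq_eq, Fin.sum_univ_add]
  simp [lastColumn, matrixPoint, blk, hl]

theorem hasStrictFDerivAt_expTilt_smul_baseVector (k : ℕ) :
    HasStrictFDerivAt (fun v : EuclideanSpace ℝ (Fin k × Fin 1) => expTilt v • baseVector k)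
      (lastColumn k ∘ₗ (matrixPointEquiv (k + 1)).toLinearMap ∘ₗ
        tiltMatrix k 1).toContinuousLinearMap 0 := by
  have h := (lastColumn k).toContinuousLinearMap.hasStrictFDerivAt
    (x := matrixPoint (NormedSpace.exp (tiltMatrix k 1 0)))
  have h2 := h.comp 0 (HasMatrixDerivAt.exp (tiltMatrix k 1))
  simp only [smul_baseVector]
  exact h2

theorem norm_lastColumn_tiltMatrix_sq {k : ℕ} (v : EuclideanSpace ℝ (Fin k × Fin 1)) :
    ‖lastColumn k (matrixPoint (tiltMatrix k 1 v))‖ ^ 2 = ‖v‖ ^ 2 := by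
  rw [tiltMatrix_apply, lastColumn_blk, sum_of_sq]
  simp

theorem isApproxSimilarity_expTilt_smul_baseVector (k : ℕ) :
    IsApproxSimilarity (fun v : EuclideanSpace ℝ (Fin k × Fin 1) => expTilt v • baseVector k) 1 :=
  (hasStrictFDerivAt_expTilt_smul_baseVector k).isApproxSimilarity fun v => by
    rw [← sq_eq_sq₀ (norm_nonneg _) (by positivity), one_mul]
    exact norm_lastColumn_tiltMatrix_sq v

theorem expTilt_zero {e d : ℕ} : expTilt (0 : EuclideanSpace ℝ (Fin e × Fin d)) = 1 := by
  apply Subtype.ext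
  change NormedSpace.exp (tiltMatrix e d 0) = 1
  simp

/-- Polar coordinates near the last basis vector. -/
def polarChart (k : ℕ) (t : EuclideanSpace ℝ (Fin 1)) (v : EuclideanSpace ℝ (Fin k × Fin 1)) :
    E (k + 1) := (1 + t 0) • expTilt v • baseVector k

/-- Polar coordinates are an isometry to first order. -/
theorem isApproxSimilarity_polarChart (k : ℕ) :
    IsApproxSimilarity (fun x : EuclideanSpace ℝ (Fin 1 ⊕ (Fin k × Fin 1)) =>
      polarChart k (coordL _ _ x) (coordR _ _ x)) 1 := by
  let p := (coordR (Fin 1) (Fin k × Fin 1)).toContinuousLinearMap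
  let q : EuclideanSpace ℝ (Fin 1 ⊕ (Fin k × Fin 1)) →L[ℝ] ℝ :=
    EuclideanSpace.proj (Sum.inl 0)
  have hp := hasStrictFDerivAt_expTilt_smul_baseVector k
  rw [← map_zero p] at hp
  have h1 := hp.comp 0 p.hasStrictFDerivAt
  have h2 := (((hasStrictFDerivAt_const (𝕜 := ℝ) (1 : ℝ) (0 : EuclideanSpace ℝ _)).add
    q.hasStrictFDerivAt).smul h1).congr_fderiv (g' := (lastColumn k ∘ₗ
      (matrixPointEquiv (k + 1)).toLinearMap ∘ₗ tiltMatrix k 1).toContinuousLinearMap ∘SL p +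
        q.smulRight (baseVector k)) (by
      have h3 : ((fun _ => (1 : ℝ)) + ⇑q : EuclideanSpace ℝ _ → ℝ) 0 = 1 := by simp
      rw [h3, one_smul, zero_add, map_zero, expTilt_zero, one_smul])
  refine HasStrictFDerivAt.isApproxSimilarity h2 fun x => ?_
  rw [← sq_eq_sq₀ (norm_nonneg _) (by positivity), one_mul, norm_sq_eq_coordL_add_coordR]
  have hx : coordR (Fin 1) (Fin k × Fin 1) x = p x := rfl
  have hq : ‖coordL (Fin 1) (Fin k × Fin 1) x‖ ^ 2 = q x ^ 2 := by
    rw [EuclideanSpace.norm_sq_eq, Fin.sum_univ_one, Real.norm_eq_abs, sq_abs]; rfl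
  have hb : baseVector k = lastColumn k (matrixPoint (blk 1 0 0 1)) := by
    rw [blk_one]
    exact (one_smul (OG (k + 1)) _).symm.trans (smul_baseVector 1)
  have hD : ((lastColumn k ∘ₗ (matrixPointEquiv (k + 1)).toLinearMap ∘ₗ
      tiltMatrix k 1).toContinuousLinearMap ∘SL p + q.smulRight (baseVector k)) x =
      lastColumn k (matrixPoint (blk (q x • 1) (Matrix.of fun i j => p x (i, j))
        (-(Matrix.of fun i j => p x (i, j)).transpose) (q x • 1))) := by
    have h0 : matrixPoint (blk (q x • 1) (Matrix.of fun i j => p x (i, j))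
        (-(Matrix.of fun i j => p x (i, j)).transpose) (q x • 1)) =
        matrixPoint (tiltMatrix k 1 (p x)) + q x • matrixPoint (blk 1 0 0 1) := by
      change matrixPointEquiv _ _ = matrixPointEquiv _ _ + q x • matrixPointEquiv _ _
      rw [← map_smul, ← map_add, tiltMatrix_apply, blk_smul, blk_add]
      simp
    rw [h0, map_add, map_smul, ← hb]
    rfl
  rw [hD, lastColumn_blk, sum_of_sq, hx, hq]
  simp [add_comm]

/-! ### Haar measure on the orthogonal group -/

/-- Haar measure on `O(n)`, of total mass one. -/
abbrev haarOG (n : ℕ) : Measure (OG n) :=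
  Measure.haarMeasure (⊤ : TopologicalSpace.PositiveCompacts (OG n))

instance haarOG.instIsProbabilityMeasure {n : ℕ} : IsProbabilityMeasure (haarOG n) :=
  ⟨by simpa using Measure.haarMeasure_self (K₀ := (⊤ : TopologicalSpace.PositiveCompacts (OG n)))⟩

instance haarOG.instIsMulRightInvariant {n : ℕ} : (haarOG n).IsMulRightInvariant := by
  refine ⟨fun g => ?_⟩
  have : IsProbabilityMeasure ((haarOG n).map (· * g)) :=
    Measure.isProbabilityMeasure_map (measurable_mul_const g).aemeasurable
  exact Measure.isHaarMeasure_eq_of_isProbabilityMeasure _ _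

/-! ### Finiteness of the volumes -/

theorem orbit_matrixPoint_one (n : ℕ) : MulAction.orbit (OG n) (matrixPoint (1 : Matrix (Fin n) (Fin n) ℝ)) =
    matrixPoint '' (Matrix.orthogonalGroup (Fin n) ℝ : Set (Matrix (Fin n) (Fin n) ℝ)) := by
  ext x
  constructor
  · rintro ⟨g, rfl⟩
    exact ⟨g.1, g.2, congrArg matrixPoint (mul_one g.1).symm⟩
  · rintro ⟨A, hA, rfl⟩
    exact ⟨⟨A, hA⟩, congrArg matrixPoint (mul_one A)⟩

/-- Restriction to some of the coordinates. -/
def coordRestrict {α β : Type*} [Fintype α] [Fintype β] (f : β → α) :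
    EuclideanSpace ℝ α →ₗ[ℝ] EuclideanSpace ℝ β where
  toFun x := WithLp.toLp 2 fun i => x (f i)
  map_add' _ _ := rfl
  map_smul' _ _ := rfl

theorem eq_zero_of_coordRestrict {α β : Type*} [Fintype α] [Fintype β] {f : β → α}
    {x : EuclideanSpace ℝ α} (h : coordRestrict f x = 0) (i : β) : x (f i) = 0 :=
  congrArg (fun y : EuclideanSpace ℝ β => y i) h

/-- `O(n)` is a level set of `A ↦ Aᵀ A`; a matrix in the kernel of the derivative at `1` is
skew-symmetric, hence determined by its entries above the diagonal. -/
theorem measure_orthogonalGroup_ne_top (n : ℕ) :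
    μHE[n * (n - 1) / 2] (MulAction.orbit (OG n) (matrixPoint (1 : Matrix (Fin n) (Fin n) ℝ))) ≠ ∞ := by
  apply measure_orbit_ne_top
  let T : EuclideanSpace ℝ (Fin n × Fin n) →ₗ[ℝ] Matrix (Fin n) (Fin n) ℝ :=
    (matrixPointEquiv n).symm.toLinearMap
  let tr : Matrix (Fin n) (Fin n) ℝ →ₗ[ℝ] Matrix (Fin n) (Fin n) ℝ :=
    (Matrix.transposeLinearEquiv _ _ ℝ ℝ).toLinearMap
  have h1 := HasMatrixDerivAt.linearMap T (x := matrixPoint 1)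
  have h2 := (h1.linearMap_comp tr).mul h1
  obtain ⟨U, hU, hfin⟩ := exists_nhds_levelSet_measure_lt_top h2 (card_upperIdx n)
    (coordRestrict (Subtype.val : UpperIdx n → _)).toContinuousLinearMap fun x hx hL => by
      have hL' : (T x).transpose * 1 + Matrix.transpose 1 * T x = 0 := matrixPoint_injective hL
      rw [mul_one, Matrix.transpose_one, one_mul] at hL'
      have hup : ∀ i j, i < j → x (i, j) = 0 := fun i j hij =>
        eq_zero_of_coordRestrict hx ⟨(i, j), hij⟩
      have hsum : ∀ i j, x (j, i) + x (i, j) = 0 := fun i j => congrFun (congrFun hL' i) j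
      ext ⟨i, j⟩
      change x (i, j) = 0
      rcases lt_trichotomy i j with h | rfl | h
      · exact hup i j h
      · linarith [hsum i i]
      · linarith [hsum i j, hup j i h]
  refine ⟨U, hU, lt_of_le_of_lt (measure_mono (inter_subset_inter_right _ ?_)) hfin⟩
  rintro _ ⟨g, rfl⟩
  change matrixPoint ((g.1 * 1).transpose * (g.1 * 1)) = matrixPoint (Matrix.transpose 1 * 1)
  simp [g.transpose_mul]

/-- The projection matrices satisfy `Pᵀ P = P`, which puts the image of `Gr.embed` in a level set of
`x ↦ √2 xᵀ x - x`; a matrix in the kernel of the derivative at the base point is determined by an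
off-diagonal block. -/
theorem measure_grassmannian_ne_top (e d : ℕ) :
    μHE[e * d] (MulAction.orbit (OG (e + d)) (basePlane e d)) ≠ ∞ := by
  apply measure_orbit_ne_top
  let n := e + d
  let T : EuclideanSpace ℝ (Fin n × Fin n) →ₗ[ℝ] Matrix (Fin n) (Fin n) ℝ :=
    (matrixPointEquiv n).symm.toLinearMap
  let tr : Matrix (Fin n) (Fin n) ℝ →ₗ[ℝ] Matrix (Fin n) (Fin n) ℝ :=
    (Matrix.transposeLinearEquiv _ _ ℝ ℝ).toLinearMap
  let y₀ : EuclideanSpace ℝ (Fin n × Fin n) := Gr.embed (basePlane e d)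
  have h1 := HasMatrixDerivAt.linearMap T (x := y₀)
  have h2 := (((h1.linearMap_comp tr).mul h1).linearMap_comp (Real.sqrt 2 • LinearMap.id)).add
    (HasMatrixDerivAt.linearMap (-T))
  obtain ⟨U, hU, hfin⟩ := exists_nhds_levelSet_measure_lt_top h2
    (κ := Fin e × Fin d) (m := e * d) (by simp)
    (coordRestrict fun p : Fin e × Fin d =>
      (Fin.castAdd d p.1, Fin.natAdd e p.2)).toContinuousLinearMap fun x hx hL => by
      obtain ⟨A, B, C, D, hxM⟩ := exists_eq_blk (T x)
      have hB : B = 0 := by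
        ext i j
        have h3 := eq_zero_of_coordRestrict hx (i, j)
        have h4 : x (Fin.castAdd d i, Fin.natAdd e j) = B i j := by
          change T x _ _ = _
          rw [hxM]; simp [blk]
        rw [← h4, h3]; rfl
      have hy : T y₀ = (Real.sqrt 2)⁻¹ • blk 0 0 0 1 := by
        change (Real.sqrt 2)⁻¹ • (basePlane e d).projMatrix = _
        rw [projMatrix_basePlane]
      have hL' : Real.sqrt 2 • ((T x).transpose * T y₀ + (T y₀).transpose * T x) + -T x = 0 :=
        matrixPoint_injective hL
      rw [hy, Matrix.transpose_smul, Matrix.mul_smul, Matrix.smul_mul, ← smul_add, smul_smul,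
        mul_inv_cancel₀ (by positivity), one_smul, hxM, blk_transpose, blk_transpose, blk_mul, blk_mul,
        blk_add, ← neg_one_smul ℝ (blk A B C D), blk_smul, blk_add] at hL'
      have h0 : (0 : Matrix (Fin (e + d)) (Fin (e + d)) ℝ) = blk 0 0 0 0 := by
        simp [blk]
      rw [h0, blk_inj] at hL'
      simp [hB] at hL'
      obtain ⟨hA, hC, hD⟩ := hL'
      have : T x = 0 := by
        rw [hxM, hA, hB, hC, hD, h0]
      exact (matrixPointEquiv n).symm.map_eq_zero_iff.1 this
  refine ⟨Gr.embed ⁻¹' U, Gr.isometry_embed.continuous.continuousAt.preimage_mem_nhds hU, ?_⟩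
  rw [← Gr.isometry_embed.euclideanHausdorffMeasure_image]
  refine lt_of_le_of_lt (measure_mono ?_) hfin
  have hzero : ∀ g : OG (e + d), Real.sqrt 2 • ((T (Gr.embed (g • basePlane e d))).transpose *
      T (Gr.embed (g • basePlane e d))) + (-T) (Gr.embed (g • basePlane e d)) = 0 := fun g => by
    have hT : T (Gr.embed (g • basePlane e d)) =
      (Real.sqrt 2)⁻¹ • (g • basePlane e d).projMatrix := rfl
    have hP : (g • basePlane e d).projMatrix.transpose * (g • basePlane e d).projMatrix =
        (g • basePlane e d).projMatrix := by
      have hb : (blk 0 0 0 1 : Matrix (Fin (e + d)) (Fin (e + d)) ℝ).transpose * blk 0 0 0 1 =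
          blk 0 0 0 1 := by
        rw [blk_transpose, blk_mul]; simp
      rw [Gr.projMatrix_smul, projMatrix_basePlane, Matrix.transpose_mul, Matrix.transpose_mul,
        Matrix.transpose_transpose]
      generalize (blk 0 0 0 1 : Matrix (Fin (e + d)) (Fin (e + d)) ℝ) = P at hb ⊢
      calc g.1 * (P.transpose * g.1.transpose) * (g.1 * P * g.1.transpose)
          = g.1 * (P.transpose * (g.1.transpose * g.1) * P) * g.1.transpose := by
            simp only [Matrix.mul_assoc]
        _ = g.1 * P * g.1.transpose := by rw [g.transpose_mul, Matrix.mul_one, hb]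
    rw [LinearMap.neg_apply, hT, Matrix.transpose_smul, Matrix.smul_mul, Matrix.mul_smul, hP,
      smul_smul, mul_inv_cancel₀ (by positivity), one_smul, add_neg_cancel]
  rintro _ ⟨_, ⟨hσ, ⟨g, rfl⟩⟩, rfl⟩
  refine ⟨hσ, congrArg matrixPoint ((hzero g).trans ?_)⟩
  have := hzero 1
  rw [one_smul] at this
  exact this.symm

/-- `O(k + 1)` acts transitively on the sphere: it does so on lines, and contains `-1`. -/
theorem orbit_baseVector (k : ℕ) :
    MulAction.orbit (OG (k + 1)) (baseVector k) = Metric.sphere 0 1 := by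
  ext x
  rw [mem_sphere_zero_iff_norm]
  constructor
  · rintro ⟨g, rfl⟩
    exact (g.norm_smul _).trans (norm_baseVector k)
  · intro hx
    have hx0 : x ≠ 0 := fun h => by simp [h] at hx
    obtain ⟨g, hg⟩ := Gr.exists_smul_eq (basePlane k 1) ⟨Submodule.span ℝ {x}, finrank_span_singleton hx0⟩
    have hmem : g • baseVector k ∈ Submodule.span ℝ {x} := by
      change _ ∈ Gr.space ⟨Submodule.span ℝ {x}, finrank_span_singleton hx0⟩
      rw [← hg, Gr.mem_smul_space]
      have := inv_smul_smul g (baseVector k)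
      rw [this]
      exact Submodule.subset_span ⟨0, rfl⟩
    obtain ⟨c, hc⟩ := Submodule.mem_span_singleton.1 hmem
    have hc1 : |c| = 1 := by
      have := congrArg norm hc
      rwa [norm_smul, hx, mul_one, g.norm_smul, norm_baseVector] at this
    rcases (abs_eq zero_le_one).1 hc1 with rfl | rfl
    · exact ⟨g, by simpa using hc.symm⟩
    · refine ⟨-g, ?_⟩
      change (-g) • baseVector k = x
      rw [OG.smul_eq_toLp, Unitary.coe_neg, Matrix.neg_mulVec, WithLp.toLp_neg, ← OG.smul_eq_toLp,
        ← hc]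
      simp

/-- The sphere is a level set of `‖x‖ ^ 2`. -/
theorem measure_sphere_ne_top (k : ℕ) :
    μHE[k] (MulAction.orbit (OG (k + 1)) (baseVector k)) ≠ ∞ := by
  apply measure_orbit_ne_top
  have h := hasStrictFDerivAt_norm_sq (F := E (k + 1)) (baseVector k)
  obtain ⟨U, hU, hfin⟩ := exists_nhds_levelSet_measure_lt_top h (Fintype.card_fin k)
    (coordRestrict (Fin.castSucc : Fin k → _)).toContinuousLinearMap fun x hx hL => by
      ext i
      refine Fin.lastCases ?_ (fun i => eq_zero_of_coordRestrict hx i) i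
      simpa [baseVector, EuclideanSpace.inner_single_left] using hL
  refine ⟨U, hU, lt_of_le_of_lt (measure_mono (inter_subset_inter_right _ ?_)) hfin⟩
  rintro _ ⟨g, rfl⟩
  simp [OG.norm_smul]

/-! ### Relations between the volumes -/

section Frobenius
open scoped Matrix.Norms.Frobenius

theorem continuous_matrix_exp (n : ℕ) :
    Continuous (NormedSpace.exp : Matrix (Fin n) (Fin n) ℝ → Matrix (Fin n) (Fin n) ℝ) :=
  NormedSpace.exp_continuous
end Frobenius

theorem continuous_expSkew {n : ℕ} : Continuous (expSkew : EuclideanSpace ℝ (UpperIdx n) → OG n) :=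
  ((continuous_matrix_exp n).comp
    (LinearMap.continuous_of_finiteDimensional (skewMatrix n))).subtype_mk _

theorem continuous_expTilt {e d : ℕ} :
    Continuous (expTilt : EuclideanSpace ℝ (Fin e × Fin d) → OG (e + d)) :=
  ((continuous_matrix_exp (e + d)).comp
    (LinearMap.continuous_of_finiteDimensional (tiltMatrix e d))).subtype_mk _

instance Gr.instSecondCountableTopology {d n : ℕ} : SecondCountableTopology (Gr d n) :=
  Gr.isometry_embed.isEmbedding.secondCountableTopology

/-- The volume of `O(n)` for the Frobenius metric. `O(n)` is seen as an orbit, of the unit matrix. -/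
def volO (n : ℕ) : ℝ :=
  (μHE[n * (n - 1) / 2] (MulAction.orbit (OG n) (matrixPoint (1 : Matrix (Fin n) (Fin n) ℝ)))).toReal

/-- The volume of `G_{d,e+d}` at scale one. -/
def volGrassmannian (e d : ℕ) : ℝ :=
  (μHE[e * d] (MulAction.orbit (OG (e + d)) (basePlane e d))).toReal

theorem smul_matrixPoint_one {n : ℕ} (g : OG n) :
    g • matrixPoint (1 : Matrix (Fin n) (Fin n) ℝ) = matrixPoint g.1 :=
  congrArg matrixPoint (mul_one g.1)

theorem setOf_smul_matrixPoint_mem {n : ℕ} {P : Type*} (f : P → OG n) (V : Set P) :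
    {g : OG n | g • matrixPoint (1 : Matrix (Fin n) (Fin n) ℝ) ∈
      (fun v => matrixPoint (f v).1) '' V} = f '' V := by
  ext g
  simp only [smul_matrixPoint_one, mem_image, mem_ofPred_eq]
  exact exists_congr fun v => and_congr_right fun _ =>
    ⟨fun h => Subtype.ext (matrixPoint_injective h), fun h => by rw [h]⟩

/-- The volume of `O(n)`, compared with its Haar measure in exponential coordinates. -/
theorem tendsto_volO_expSkew (n : ℕ) :
    Tendsto (fun r : ℝ => volO n * (haarOG n).real (expSkew '' box (UpperIdx n) r) /
      (2 * r) ^ (n * (n - 1) / 2)) (𝓝[>] 0) (𝓝 (Real.sqrt 2 ^ (n * (n - 1) / 2))) := by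
  have := tendsto_orbit_measure (haarOG n) (card_upperIdx n) _ (measure_orthogonalGroup_ne_top n)
    (by positivity) (isApproxSimilarity_expSkew n) fun v => ⟨expSkew v, smul_matrixPoint_one _⟩
  simp only [setOf_smul_matrixPoint_mem] at this
  exact this

/-- The dimension of `O(e + d)` is the sum of those of base and fibre. -/
theorem choose_two_add (e d : ℕ) : (e + d) * (e + d - 1) / 2 =
    e * d + (e * (e - 1) / 2 + d * (d - 1) / 2) := by
  simp only [← Nat.choose_two_right]
  induction d with
  | zero => simp
  | succ d ih =>
    rw [← add_assoc, Nat.choose_succ_succ' (e + d) 1, ih, Nat.choose_succ_succ' d 1]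
    simp only [Nat.choose_one_right]
    ring

/-- The volume of `O(e + d)`, compared with its Haar measure in the coordinates of the fibration. -/
theorem tendsto_volO_fibrationChart (e d : ℕ) :
    Tendsto (fun r : ℝ => volO (e + d) * (haarOG (e + d)).real (image2 (fibrationChart e d)
      (box (Fin e × Fin d) r) (box (UpperIdx e ⊕ UpperIdx d) r)) /
        (2 * r) ^ ((e + d) * (e + d - 1) / 2)) (𝓝[>] 0)
      (𝓝 (Real.sqrt 2 ^ ((e + d) * (e + d - 1) / 2))) := by
  have hcard : Fintype.card ((Fin e × Fin d) ⊕ (UpperIdx e ⊕ UpperIdx d)) =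
      (e + d) * (e + d - 1) / 2 := by
    rw [Fintype.card_sum, Fintype.card_sum, card_upperIdx, card_upperIdx, choose_two_add]
    simp
  have := tendsto_orbit_measure (haarOG (e + d)) hcard _ (measure_orthogonalGroup_ne_top (e + d))
    (by positivity) (isApproxSimilarity_fibrationChart e d) fun v => ⟨_, smul_matrixPoint_one _⟩
  simp only [setOf_smul_matrixPoint_mem (fun x : EuclideanSpace ℝ ((Fin e × Fin d) ⊕
    (UpperIdx e ⊕ UpperIdx d)) => fibrationChart e d (coordL _ _ x) (coordR _ _ x)),
    image2_coord_box] at this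
  exact this

/-- The volume of the Grassmannian, compared with the Haar measure on `O(e + d)`. -/
theorem tendsto_volGrassmannian (e d : ℕ) :
    Tendsto (fun r : ℝ => volGrassmannian e d * (haarOG (e + d)).real
      {g | g • basePlane e d ∈ (fun v => expTilt v • basePlane e d) '' box (Fin e × Fin d) r} /
        (2 * r) ^ (e * d)) (𝓝[>] 0) (𝓝 1) := by
  have := tendsto_orbit_measure (haarOG (e + d)) (κ := Fin e × Fin d) (m := e * d) (by simp) _
    (measure_grassmannian_ne_top e d) one_pos (isApproxSimilarity_expTilt_smul_basePlane e d)
    fun v => ⟨_, rfl⟩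
  rw [one_pow] at this
  exact this

/-- The Haar measure of a small chart cube of `O(e + d)` is the product of the measures of its
shadow on the Grassmannian and of the cubes in `O(e)` and `O(d)`. -/
theorem eventually_measure_fibrationChart (e d : ℕ) : ∀ᶠ r in 𝓝[>] (0 : ℝ),
    (haarOG (e + d)).real (image2 (fibrationChart e d)
      (box (Fin e × Fin d) r) (box (UpperIdx e ⊕ UpperIdx d) r)) =
    (haarOG (e + d)).real
      {g | g • basePlane e d ∈ (fun v => expTilt v • basePlane e d) '' box (Fin e × Fin d) r} *
      ((haarOG e).real (expSkew '' box (UpperIdx e) r) *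
        (haarOG d).real (expSkew '' box (UpperIdx d) r)) := by
  filter_upwards [(isApproxSimilarity_expTilt_smul_basePlane e d).eventually_injOn one_pos]
    with r hr
  set H : Set (OG e × OG d) :=
    (expSkew '' box (UpperIdx e) r) ×ˢ (expSkew '' box (UpperIdx d) r) with hH
  have hHc : IsCompact H :=
    ((isCompact_box _ r).image continuous_expSkew).prod ((isCompact_box _ r).image continuous_expSkew)
  have hW : image2 (fibrationChart e d) (box (Fin e × Fin d) r) (box (UpperIdx e ⊕ UpperIdx d) r) =
      image2 (fun v h => expTilt v * blockHom e d h) (box (Fin e × Fin d) r) H := by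
    have : H = (fun h => (expSkew (coordL (UpperIdx e) (UpperIdx d) h),
        expSkew (coordR (UpperIdx e) (UpperIdx d) h))) '' box (UpperIdx e ⊕ UpperIdx d) r := by
      rw [image2_coord_box (fun a b => ((expSkew a : OG e), (expSkew b : OG d))), hH,
        ← image2_mk_eq_prod, image2_image_left, image2_image_right]
    rw [this, image2_image_right]
    rfl
  have hWc : IsCompact (image2 (fun v h => expTilt v * blockHom e d h) (box (Fin e × Fin d) r) H) :=
    image_prod (fun v h => expTilt v * blockHom e d h) ▸ ((isCompact_box _ r).prod hHc).image
      ((continuous_expTilt.comp continuous_fst).mul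
        ((continuous_blockHom e d).comp continuous_snd))
  have hVc : IsCompact ((fun v => expTilt v • basePlane e d) '' box (Fin e × Fin d) r) :=
    (isCompact_box _ r).image (continuous_expTilt.smul continuous_const)
  have hmV : MeasurableSet {g : OG (e + d) |
      g • basePlane e d ∈ (fun v => expTilt v • basePlane e d) '' box (Fin e × Fin d) r} :=
    (hVc.isClosed.preimage (continuous_id.smul continuous_const)).measurableSet
  have key := measure_image_section_mul (haarOG (e + d)) ((haarOG e).prod (haarOG d))
    (blockHom e d) (continuous_blockHom e d) (blockHom_injective e d) (basePlane e d)
    smul_basePlane_eq_iff expTilt (box (Fin e × Fin d) r) hr H hmV hWc.isClosed.measurableSet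
  rw [hW, Measure.real, key, hH, Measure.prod_prod, ENNReal.toReal_mul, ENNReal.toReal_mul]
  rfl

/-- The volume of `O(e + d)` is the product of those of the base and of the fibre of the fibration
`O(e + d) → O(e + d) / (O(e) × O(d))`, whose horizontal directions are stretched by `√2`. -/
theorem volO_add (e d : ℕ) :
    volO (e + d) = Real.sqrt 2 ^ (e * d) * (volGrassmannian e d * volO e * volO d) := by
  have h1 := tendsto_volO_fibrationChart e d
  have h2 := (tendsto_volGrassmannian e d).mul
    ((tendsto_volO_expSkew e).mul (tendsto_volO_expSkew d))
  have h3 := h1.const_mul (volGrassmannian e d * volO e * volO d)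
  have h4 := h2.const_mul (volO (e + d))
  have h5 := tendsto_nhds_unique_of_eventuallyEq h3 h4 (by
    filter_upwards [eventually_measure_fibrationChart e d, self_mem_nhdsWithin] with r hr hr0
    have hr0 : r ≠ 0 := ne_of_gt hr0
    rw [hr, choose_two_add, pow_add, pow_add]
    field_simp)
  rw [choose_two_add, pow_add, pow_add] at h5
  have h6 : Real.sqrt 2 ^ (e * (e - 1) / 2) * Real.sqrt 2 ^ (d * (d - 1) / 2) ≠ 0 := by positivity
  apply mul_right_cancel₀ h6
  linear_combination -h5

theorem volO_ne_zero (n : ℕ) : volO n ≠ 0 := by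
  intro h
  have h1 := tendsto_volO_expSkew n
  simp only [h, zero_mul, zero_div] at h1
  exact (by positivity : Real.sqrt 2 ^ (n * (n - 1) / 2) ≠ 0)
    (tendsto_nhds_unique h1 tendsto_const_nhds)

/-- The volume of `SO(n)` is half the volume of `O(n)`: the other component is its image under
multiplication by a reflection. -/
theorem volO_eq_two_mul_volSO {n : ℕ} (hn : 1 ≤ n) : volO n = 2 * volSO n := by
  obtain ⟨R, hR⟩ : ∃ R : OG n, R.1.det = -1 := by
    obtain ⟨m, rfl⟩ := Nat.exists_eq_add_of_le' hn
    refine ⟨⟨Matrix.diagonal (Fin.cons (-1) fun _ => 1), ?_⟩, ?_⟩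
    · rw [Matrix.mem_orthogonalGroup_iff', Matrix.diagonal_transpose, Matrix.diagonal_mul_diagonal,
        ← Matrix.diagonal_one]
      congr 1
      funext i
      refine Fin.cases ?_ (fun i => ?_) i <;> simp
    · simp [Matrix.det_diagonal, Fin.prod_univ_succ]
  set S : Set (EuclideanSpace ℝ (Fin n × Fin n)) := matrixPoint ''
    (Matrix.specialOrthogonalGroup (Fin n) ℝ : Set (Matrix (Fin n) (Fin n) ℝ)) with hS
  have hdet : ∀ g : OG n, g.1.det = 1 ∨ g.1.det = -1 := fun g => by
    have := congrArg Matrix.det g.transpose_mul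
    rw [Matrix.det_mul, Matrix.det_transpose, Matrix.det_one] at this
    exact mul_self_eq_one_iff.1 this
  have hmem : ∀ A : Matrix (Fin n) (Fin n) ℝ, matrixPoint A ∈ S ↔
      A ∈ Matrix.orthogonalGroup (Fin n) ℝ ∧ A.det = 1 := fun A => by
    rw [hS, matrixPoint_injective.mem_set_image]
    exact Matrix.mem_specialOrthogonalGroup_iff
  have hunion : MulAction.orbit (OG n) (matrixPoint (1 : Matrix (Fin n) (Fin n) ℝ)) =
      S ∪ (fun x => R • x) '' S := by
    rw [orbit_matrixPoint_one]
    ext x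
    obtain ⟨A, rfl⟩ := (matrixPointEquiv n).surjective x
    change matrixPoint A ∈ _ ↔ matrixPoint A ∈ _
    rw [matrixPoint_injective.mem_set_image, mem_union, hmem]
    constructor
    · intro hA
      rcases hdet ⟨A, hA⟩ with h | h
      · exact Or.inl ⟨hA, h⟩
      · refine Or.inr ⟨matrixPoint ((R⁻¹ : OG n).1 * A), (hmem _).2
          ⟨mul_mem (R⁻¹ : OG n).2 hA, ?_⟩, ?_⟩
        · have h' : A.det = -1 := h
          rw [Matrix.det_mul, OG.coe_inv, Matrix.det_transpose, hR, h']; norm_num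
        · change matrixPoint (R.1 * ((R⁻¹ : OG n).1 * A)) = _
          rw [OG.coe_inv, ← Matrix.mul_assoc, R.mul_transpose, Matrix.one_mul]
    · rintro (h | ⟨y, hy, hyA⟩)
      · exact h.1
      · obtain ⟨B, rfl⟩ := (matrixPointEquiv n).surjective y
        rw [← matrixPoint_injective hyA]
        exact mul_mem R.2 ((hmem B).1 hy).1
  have hdisj : Disjoint S ((fun x => R • x) '' S) := by
    rw [Set.disjoint_right]
    rintro _ ⟨y, hy, rfl⟩ h
    obtain ⟨B, rfl⟩ := (matrixPointEquiv n).surjective y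
    have h1 := ((hmem _).1 hy).2
    have h2 : (R.1 * B).det = 1 := ((hmem _).1 h).2
    rw [Matrix.det_mul, hR, h1] at h2
    norm_num at h2
  have hSmeas : MeasurableSet S := by
    have : S = MulAction.orbit (OG n) (matrixPoint (1 : Matrix (Fin n) (Fin n) ℝ)) ∩
        {x | ((matrixPointEquiv n).symm x).det = 1} := by
      ext x
      obtain ⟨A, rfl⟩ := (matrixPointEquiv n).surjective x
      rw [orbit_matrixPoint_one]
      change matrixPoint A ∈ _ ↔ matrixPoint A ∈ _ ∧ A.det = 1
      rw [hmem, matrixPoint_injective.mem_set_image]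
      rfl
    rw [this]
    exact ((isCompact_orbit _).isClosed.inter
      (isClosed_eq continuous_matrixPointEquiv_symm.matrix_det continuous_const)).measurableSet
  have hfin : μHE[n * (n - 1) / 2] S ≠ ∞ :=
    ne_top_of_le_ne_top (measure_orthogonalGroup_ne_top n)
      (measure_mono (hunion ▸ subset_union_left))
  have hRm : MeasurableSet ((fun x => R • x) '' S) :=
    (MeasurableEquiv.smul R).measurableSet_image.2 hSmeas
  rw [volO, hunion, measure_union hdisj hRm,
    (isometry_smul _ R).euclideanHausdorffMeasure_image, ENNReal.toReal_add hfin hfin, volSO]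
  ring

theorem volO_one : volO 1 = 2 := by
  rw [volO_eq_two_mul_volSO le_rfl, volSO]
  have : (Matrix.specialOrthogonalGroup (Fin 1) ℝ : Set (Matrix (Fin 1) (Fin 1) ℝ)) = {1} := by
    ext A
    rw [SetLike.mem_coe, Matrix.mem_specialOrthogonalGroup_iff, mem_singleton_iff]
    constructor
    · rintro ⟨-, h⟩
      rw [Matrix.det_fin_one] at h
      ext i j
      rw [Subsingleton.elim i 0, Subsingleton.elim j 0, h]; simp
    · rintro rfl
      exact ⟨one_mem _, Matrix.det_one⟩
  rw [this, image_singleton]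
  simp

theorem volSphere_eq_orbit (k : ℕ) :
    volSphere k = (μHE[k] (MulAction.orbit (OG (k + 1)) (baseVector k))).toReal := by
  rw [orbit_baseVector]; rfl

/-- The volume of the sphere, compared with the Haar measure on `O(k + 1)`. -/
theorem tendsto_volSphere (k : ℕ) :
    Tendsto (fun r : ℝ => volSphere k * (haarOG (k + 1)).real
      {g | g • baseVector k ∈ (fun v => expTilt v • baseVector k) '' box (Fin k × Fin 1) r} /
        (2 * r) ^ k) (𝓝[>] 0) (𝓝 1) := by
  have := tendsto_orbit_measure (haarOG (k + 1)) (κ := Fin k × Fin 1) (m := k) (by simp) _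
    (measure_sphere_ne_top k) one_pos (isApproxSimilarity_expTilt_smul_baseVector k)
    fun v => ⟨_, rfl⟩
  simpa only [one_pow, ← volSphere_eq_orbit] using this

/-! ### The volume of the sphere -/

theorem smul_baseLine_space {k : ℕ} (g : OG (k + 1)) :
    (g • basePlane k 1 : Gr 1 (k + 1)).space = Submodule.span ℝ {g • baseVector k} := by
  have h : (basePlane k 1).space = Submodule.span ℝ {baseVector k} := by
    change Submodule.span ℝ (range fun i : Fin 1 => EuclideanSpace.single (Fin.natAdd k i) (1 : ℝ)) = _
    rw [range_unique]
    rfl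
  rw [Gr.smul_space, h, Submodule.map_span, image_singleton]
  rfl

theorem smul_baseLine_eq_iff {k : ℕ} (g h : OG (k + 1)) :
    g • basePlane k 1 = h • basePlane k 1 ↔
      g • baseVector k = h • baseVector k ∨ g • baseVector k = -(h • baseVector k) := by
  have h1 : g • basePlane k 1 = h • basePlane k 1 ↔
      Submodule.span ℝ {g • baseVector k} = Submodule.span ℝ {h • baseVector k} := by
    rw [← smul_baseLine_space, ← smul_baseLine_space]
    exact Subtype.ext_iff
  rw [h1]
  constructor
  · intro hs
    obtain ⟨c, hc⟩ := Submodule.mem_span_singleton.1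
      (hs ▸ Submodule.mem_span_singleton_self (g • baseVector k))
    have hc1 : |c| = 1 := by
      have := congrArg norm hc
      rwa [norm_smul, OG.norm_smul, OG.norm_smul, norm_baseVector, mul_one] at this
    rcases (abs_eq zero_le_one).1 hc1 with rfl | rfl
    · exact Or.inl (by rw [← hc, one_smul])
    · exact Or.inr (by rw [← hc, neg_one_smul])
  · rintro (hs | hs)
    · rw [hs]
    · rw [hs, ← Set.neg_singleton, Submodule.span_neg]

/-- The sphere covers the space of lines twice. -/
theorem volSphere_eq_two_mul_volGrassmannian (k : ℕ) : volSphere k = 2 * volGrassmannian k 1 := by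
  have h1 := tendsto_volSphere k
  have h2 := tendsto_volGrassmannian k 1
  rw [mul_one] at h2
  have hsim := isApproxSimilarity_expTilt_smul_baseVector k
  have hball : ∀ᶠ r in 𝓝[>] (0 : ℝ), ∀ x ∈ box (Fin k × Fin 1) r, x ∈ Metric.ball 0 (1 / 4) :=
    eventually_forall_mem_box (Metric.ball_mem_nhds _ (by norm_num))
  have hev : ∀ᶠ r in 𝓝[>] (0 : ℝ), (haarOG (k + 1)).real
      {g | g • basePlane k 1 ∈ (fun v => expTilt v • basePlane k 1) '' box (Fin k × Fin 1) r} =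
      2 * (haarOG (k + 1)).real
        {g | g • baseVector k ∈ (fun v => expTilt v • baseVector k) '' box (Fin k × Fin 1) r} := by
    filter_upwards [hsim.eventually_box one_pos, hball] with r hr hb
    set A : Set (OG (k + 1)) :=
      {g | g • baseVector k ∈ (fun v => expTilt v • baseVector k) '' box (Fin k × Fin 1) r} with hA
    have hneg : ∀ g : OG (k + 1), (-g) • baseVector k = -(g • baseVector k) := fun g => by
      rw [OG.smul_eq_toLp, Unitary.coe_neg, Matrix.neg_mulVec, WithLp.toLp_neg, ← OG.smul_eq_toLp]
    have hunion : {g | g • basePlane k 1 ∈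
        (fun v => expTilt v • basePlane k 1) '' box (Fin k × Fin 1) r} = A ∪ (fun g => -1 * g) ⁻¹' A := by
      ext g
      have hmem : ∀ v : EuclideanSpace ℝ (Fin k × Fin 1),
          expTilt v • basePlane k 1 = g • basePlane k 1 ↔
          expTilt v • baseVector k = g • baseVector k ∨
            expTilt v • baseVector k = -(g • baseVector k) := fun v => smul_baseLine_eq_iff _ _
      constructor
      · rintro ⟨v, hv, hvg⟩
        rcases (hmem v).1 hvg with h | h
        · exact Or.inl ⟨v, hv, h⟩
        · refine Or.inr ⟨v, hv, ?_⟩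
          change _ = (-1 * g) • baseVector k
          rw [neg_one_mul, hneg]; exact h
      · rintro (⟨v, hv, h⟩ | ⟨v, hv, h⟩)
        · exact ⟨v, hv, (hmem v).2 (Or.inl h)⟩
        · refine ⟨v, hv, (hmem v).2 (Or.inr ?_)⟩
          have h : _ = (-1 * g) • baseVector k := h
          rw [neg_one_mul, hneg] at h; exact h
    have hdisj : Disjoint A ((fun g => -1 * g) ⁻¹' A) := by
      rw [Set.disjoint_left]
      rintro g ⟨v, hv, h⟩ ⟨w, hw, h'⟩
      have h' : _ = (-1 * g) • baseVector k := h'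
      have h : _ = g • baseVector k := h
      rw [neg_one_mul, hneg, ← h] at h'
      have h3 := (abs_le.1 (hr v hv w hw)).2
      have h4 : dist (expTilt v • baseVector k) (expTilt w • baseVector k) = 2 := by
        have : expTilt w • baseVector k = -(expTilt v • baseVector k) := h'
        rw [this, dist_eq_norm, sub_neg_eq_add, ← two_smul ℝ, norm_smul, OG.norm_smul,
          norm_baseVector]
        simp
      have h5 : dist v w < 1 := by
        have h6 := Metric.mem_ball.1 (hb v hv)
        have h7 := Metric.mem_ball'.1 (hb w hw)
        linarith [dist_triangle v 0 w]
      have h3' : dist (expTilt v • baseVector k) (expTilt w • baseVector k) - 1 * dist v w ≤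
        1 * dist v w := h3
      linarith
    have hAm : MeasurableSet A :=
      ((((isCompact_box _ r).image (continuous_expTilt.smul continuous_const)).isClosed).preimage
        (continuous_id.smul continuous_const)).measurableSet
    rw [hunion, measureReal_union hdisj (measurable_const_mul _ hAm)]
    have : (haarOG (k + 1)).real ((fun g => -1 * g) ⁻¹' A) = (haarOG (k + 1)).real A := by
      rw [Measure.real, measure_preimage_mul]; rfl
    rw [this]; ring
  have h3 := h1.const_mul (2 * volGrassmannian k 1)
  have h4 := h2.const_mul (volSphere k)
  have := tendsto_nhds_unique_of_eventuallyEq h4 h3 (by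
    filter_upwards [hev] with r hr
    rw [hr]; ring)
  simpa using this

/-- The radial projection to the sphere. -/
def radialProj {n : ℕ} (x : E n) : E n := ‖x‖⁻¹ • x

theorem measurable_radialProj {n : ℕ} : Measurable (radialProj : E n → E n) :=
  measurable_norm.inv.smul measurable_id

theorem radialProj_smul {n : ℕ} {c : ℝ} (hc : 0 < c) (x : E n) :
    radialProj (c • x) = radialProj x := by
  rw [radialProj, radialProj, norm_smul, Real.norm_of_nonneg hc.le, mul_inv, smul_smul]
  congr 1
  field_simp

/-- The distribution of the direction of a uniformly distributed point of the unit ball is the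
invariant measure of the sphere. -/
theorem volume_radialProj_preimage (k : ℕ) {S : Set (E (k + 1))} (hS : MeasurableSet S) :
    (volume (radialProj ⁻¹' S ∩ Metric.closedBall 0 1)).toReal =
      (volume (Metric.closedBall (0 : E (k + 1)) 1)).toReal *
        (haarOG (k + 1)).real {g | g • baseVector k ∈ S} := by
  set ν : Measure (E (k + 1)) :=
    (volume.restrict (Metric.closedBall 0 1)).map radialProj with hν
  have hfin : IsFiniteMeasure (volume.restrict (Metric.closedBall (0 : E (k + 1)) 1)) :=
    ⟨by rw [Measure.restrict_apply_univ]; exact measure_closedBall_lt_top⟩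
  have hνfin : IsFiniteMeasure ν := Measure.isFiniteMeasure_map _ _
  have hνS : ∀ T : Set (E (k + 1)), MeasurableSet T →
      ν T = volume (radialProj ⁻¹' T ∩ Metric.closedBall 0 1) := fun T hT => by
    rw [hν, Measure.map_apply measurable_radialProj hT,
      Measure.restrict_apply (measurable_radialProj hT)]
  have hinv : ∀ g : OG (k + 1), ν.map (g • ·) = ν := fun g => by
    ext T hT
    have hg : Measurable fun x : E (k + 1) => g • x := (continuous_const_smul g).measurable
    rw [Measure.map_apply hg hT, hνS _ (hg hT), hνS _ hT]
    have hp := g.toIsometryEquiv.measurePreserving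
    rw [← hp.measure_preimage
      ((measurable_radialProj hT).inter Metric.isClosed_closedBall.measurableSet).nullMeasurableSet]
    congr 1
    ext x
    have h1 : radialProj (g.toIsometryEquiv x) = g • radialProj x := by
      rw [radialProj, LinearIsometryEquiv.norm_map, ← map_smul]; rfl
    simp [h1]
  have h0 : ν (MulAction.orbit (OG (k + 1)) (baseVector k))ᶜ = 0 := by
    rw [orbit_baseVector, hνS _ Metric.isClosed_sphere.measurableSet.compl]
    refine measure_mono_null (t := {0}) ?_ (measure_singleton _)
    rintro x ⟨hx, -⟩
    by_contra hx0
    apply hx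
    have : ‖x‖ ≠ 0 := norm_ne_zero_iff.2 hx0
    rw [mem_sphere_zero_iff_norm, radialProj, norm_smul, norm_inv, norm_norm,
      inv_mul_cancel₀ this]
  have key := congrArg (fun m : Measure (E (k + 1)) => (m S).toReal)
    (eq_smul_map_of_invariant (haarOG (k + 1)) ν hinv (baseVector k) h0)
  have hm : Measurable fun g : OG (k + 1) => g • baseVector k :=
    (continuous_id.smul continuous_const).measurable
  simp only [Measure.smul_apply, smul_eq_mul, ENNReal.toReal_mul, hνS S hS,
    hνS univ MeasurableSet.univ, Measure.map_apply hm hS, preimage_univ, univ_inter] at key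
  exact key

/-- The volume of a truncated cone. -/
theorem volume_truncated_cone {k : ℕ} {S : Set (E (k + 1))} (hS : MeasurableSet S) {r : ℝ}
    (hr0 : 0 < r) (hr1 : r < 1) :
    (volume (radialProj ⁻¹' S ∩ {x | ‖x‖ ∈ Icc (1 - r) (1 + r)})).toReal =
      ((1 + r) ^ (k + 1) - (1 - r) ^ (k + 1)) *
        (volume (radialProj ⁻¹' S ∩ Metric.closedBall 0 1)).toReal := by
  have hmS := measurable_radialProj hS
  have hball : ∀ t : ℝ, 0 < t → volume (radialProj ⁻¹' S ∩ Metric.closedBall 0 t) =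
      ENNReal.ofReal (t ^ (k + 1)) * volume (radialProj ⁻¹' S ∩ Metric.closedBall 0 1) := by
    intro t ht
    have : radialProj ⁻¹' S ∩ Metric.closedBall 0 t =
        (fun x => t • x) '' (radialProj ⁻¹' S ∩ Metric.closedBall 0 1) := by
      ext x
      constructor
      · rintro ⟨hx, hxt⟩
        refine ⟨t⁻¹ • x, ⟨?_, ?_⟩, by simp [ht.ne']⟩
        · rwa [mem_preimage, radialProj_smul (by positivity)]
        · rw [mem_closedBall_zero_iff] at hxt ⊢
          rw [norm_smul, norm_inv, Real.norm_of_nonneg ht.le, inv_mul_le_iff₀ ht, mul_one]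
          exact hxt
      · rintro ⟨y, ⟨hy, hy1⟩, rfl⟩
        refine ⟨by rwa [mem_preimage, radialProj_smul ht], ?_⟩
        rw [mem_closedBall_zero_iff] at hy1 ⊢
        rw [norm_smul, Real.norm_of_nonneg ht.le]
        nlinarith
    rw [this, image_smul, Measure.addHaar_smul, finrank_euclideanSpace_fin,
      abs_of_nonneg (by positivity)]
  have hopen : volume (radialProj ⁻¹' S ∩ Metric.ball 0 (1 - r)) =
      volume (radialProj ⁻¹' S ∩ Metric.closedBall 0 (1 - r)) := by
    refine measure_congr (EventuallyEq.inter (ae_eq_refl _) ?_)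
    refine ae_eq_of_subset_of_measure_ge Metric.ball_subset_closedBall ?_
      Metric.isOpen_ball.measurableSet.nullMeasurableSet measure_closedBall_lt_top.ne
    rw [Measure.addHaar_closedBall_eq_addHaar_ball]
  have hset : radialProj ⁻¹' S ∩ {x : E (k + 1) | ‖x‖ ∈ Icc (1 - r) (1 + r)} =
      (radialProj ⁻¹' S ∩ Metric.closedBall 0 (1 + r)) \
        (radialProj ⁻¹' S ∩ Metric.ball 0 (1 - r)) := by
    ext x
    simp only [mem_inter_iff, mem_ofPred_eq, mem_Icc, Set.mem_sdiff, mem_closedBall_zero_iff,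
      mem_ball_zero_iff, not_and, not_lt]
    tauto
  have hfin : ∀ t : ℝ, volume (radialProj ⁻¹' S ∩ Metric.closedBall 0 t) ≠ ∞ := fun t =>
    ne_top_of_le_ne_top measure_closedBall_lt_top.ne (measure_mono inter_subset_right)
  have hball' : ∀ t : ℝ, 0 < t → (volume (radialProj ⁻¹' S ∩ Metric.closedBall 0 t)).toReal =
      t ^ (k + 1) * (volume (radialProj ⁻¹' S ∩ Metric.closedBall 0 1)).toReal := fun t ht => by
    rw [hball t ht, ENNReal.toReal_mul, ENNReal.toReal_ofReal (by positivity)]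
  have hsub : radialProj ⁻¹' S ∩ Metric.ball 0 (1 - r) ⊆
      radialProj ⁻¹' S ∩ Metric.closedBall 0 (1 + r) :=
    inter_subset_inter_right _ ((Metric.ball_subset_ball (by linarith)).trans
      Metric.ball_subset_closedBall)
  rw [hset, measure_sdiff hsub
    (hmS.inter Metric.isOpen_ball.measurableSet).nullMeasurableSet (hopen ▸ hfin _),
    ENNReal.toReal_sub_of_le (measure_mono hsub) (hfin _), hopen, hball' (1 + r) (by linarith),
    hball' (1 - r) (by linarith), sub_mul]

theorem tendsto_pow_sub_pow_div (k : ℕ) :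
    Tendsto (fun r : ℝ => ((1 + r) ^ (k + 1) - (1 - r) ^ (k + 1)) / (2 * r)) (𝓝[>] 0)
      (𝓝 (k + 1)) := by
  have hd : HasDerivAt (fun r : ℝ => (1 + r) ^ (k + 1) - (1 - r) ^ (k + 1)) (2 * (k + 1)) 0 := by
    have h1 := ((hasDerivAt_id (0 : ℝ)).const_add 1).pow (k + 1)
    have h2 := ((hasDerivAt_id (0 : ℝ)).const_sub 1).pow (k + 1)
    refine (h1.sub h2).congr_deriv ?_
    simp
    ring
  have h := (hasDerivAt_iff_tendsto_slope.1 hd).mono_left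
    (nhdsWithin_mono 0 fun x (hx : 0 < x) => hx.ne')
  have h2 := h.const_mul (2⁻¹ : ℝ)
  rw [show (2⁻¹ : ℝ) * (2 * (k + 1)) = k + 1 by ring] at h2
  refine h2.congr' ?_
  filter_upwards [self_mem_nhdsWithin] with r hr
  have hr : r ≠ 0 := ne_of_gt hr
  simp [slope_def_field]
  field_simp

/-- Comparison of a cube in polar coordinates with its trace on the sphere: the cube is a truncated
cone, whose volume is known from that of the ball. -/
theorem volSphere_eq_mul_volume_ball (k : ℕ) :
    volSphere k = (k + 1) * (volume (Metric.closedBall (0 : E (k + 1)) 1)).toReal := by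
  set ω := (volume (Metric.closedBall (0 : E (k + 1)) 1)).toReal
  have h1 := tendsto_volSphere k
  have h2 := (isApproxSimilarity_polarChart k).tendsto_measure_image_box one_pos (m := k + 1)
    (by simp [add_comm])
  have hv : (μHE[k + 1] : Measure (E (k + 1))) = volume :=
    EuclideanSpace.euclideanHausdorffMeasure_eq_volume _
  rw [one_pow, hv] at h2
  set p : ℝ → ℝ := fun r => (haarOG (k + 1)).real
    {g | g • baseVector k ∈ (fun v => expTilt v • baseVector k) '' box (Fin k × Fin 1) r} with hp
  have h3 : ∀ᶠ r in 𝓝[>] (0 : ℝ), (volume ((fun x : EuclideanSpace ℝ (Fin 1 ⊕ (Fin k × Fin 1)) =>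
      polarChart k (coordL _ _ x) (coordR _ _ x)) '' box (Fin 1 ⊕ (Fin k × Fin 1)) r)).toReal /
        (2 * r) ^ (k + 1) =
      ((1 + r) ^ (k + 1) - (1 - r) ^ (k + 1)) / (2 * r) * (ω * (p r / (2 * r) ^ k)) := by
    filter_upwards [Ioo_mem_nhdsGT one_pos] with r hr
    have hr0 := hr.1
    set S := (fun v => expTilt v • baseVector k) '' box (Fin k × Fin 1) r with hS
    have hSm : MeasurableSet S :=
      ((isCompact_box _ r).image (continuous_expTilt.smul continuous_const)).isClosed.measurableSet
    have himg : (fun x : EuclideanSpace ℝ (Fin 1 ⊕ (Fin k × Fin 1)) =>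
        polarChart k (coordL _ _ x) (coordR _ _ x)) '' box (Fin 1 ⊕ (Fin k × Fin 1)) r =
        radialProj ⁻¹' S ∩ {x | ‖x‖ ∈ Icc (1 - r) (1 + r)} := by
      rw [image2_coord_box]
      have hn : ∀ v : EuclideanSpace ℝ (Fin k × Fin 1), ‖expTilt v • baseVector k‖ = 1 :=
        fun v => (OG.norm_smul _ _).trans (norm_baseVector k)
      ext x
      constructor
      · rintro ⟨t, ht, v, hv, rfl⟩
        have ht0 := ht 0
        have hpos : 0 < 1 + t 0 := by linarith [ht0.1, hr.2]
        constructor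
        · rw [mem_preimage, polarChart, radialProj_smul hpos, radialProj, hn]
          simpa using ⟨v, hv, rfl⟩
        · rw [mem_ofPred_eq, polarChart, norm_smul, hn, Real.norm_of_nonneg hpos.le]
          constructor <;> linarith [ht0.1, ht0.2]
      · rintro ⟨⟨v, hv, hvx⟩, hx⟩
        have hx : ‖x‖ ∈ Icc (1 - r) (1 + r) := hx
        have hx0 : ‖x‖ ≠ 0 := by linarith [hx.1, hr.2]
        refine ⟨WithLp.toLp 2 fun _ => ‖x‖ - 1, fun i => ?_, v, hv, ?_⟩
        · exact ⟨by simpa using by linarith [hx.1], by simpa using by linarith [hx.2]⟩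
        · have hvx : expTilt v • baseVector k = ‖x‖⁻¹ • x := hvx
          rw [polarChart, hvx, smul_smul]
          simp [hx0]
    rw [himg, volume_truncated_cone hSm hr.1 hr.2, volume_radialProj_preimage k hSm]
    change _ * (ω * p r) / _ = _
    generalize (1 + r) ^ (k + 1) - (1 - r) ^ (k + 1) = D
    rw [pow_succ]
    field_simp
  have h4 := (h2.congr' h3).const_mul (volSphere k)
  have h5 := (tendsto_pow_sub_pow_div k).mul (h1.const_mul ω)
  have := tendsto_nhds_unique_of_eventuallyEq h4 h5 (Eventually.of_forall fun r => by
    simp only [hp]; ring)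
  linear_combination this

/-- The volume of the unit sphere, from Mathlib's formula for the volume of the ball. -/
theorem volSphere_eq (k : ℕ) :
    volSphere k = 2 * Real.pi ^ (((k : ℝ) + 1) / 2) / Real.Gamma (((k : ℝ) + 1) / 2) := by
  have hG : Real.Gamma (((k : ℝ) + 1) / 2 + 1) = ((k : ℝ) + 1) / 2 * Real.Gamma (((k : ℝ) + 1) / 2) :=
    Real.Gamma_add_one (by positivity)
  have hpos : 0 < Real.Gamma (((k : ℝ) + 1) / 2) := Real.Gamma_pos_of_pos (by positivity)
  have hpi : Real.sqrt Real.pi ^ (k + 1) = Real.pi ^ (((k : ℝ) + 1) / 2) := by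
    rw [Real.sqrt_eq_rpow, ← Real.rpow_natCast, ← Real.rpow_mul Real.pi_pos.le]
    congr 1
    push_cast
    ring
  rw [volSphere_eq_mul_volume_ball, EuclideanSpace.volume_closedBall]
  simp only [Fintype.card_fin, ENNReal.ofReal_one, one_pow, one_mul]
  rw [ENNReal.toReal_ofReal (by positivity), hpi]
  push_cast
  rw [hG]
  field_simp

/-! ### The volume formula -/

/-- The fibration of `O(k + 1)` over the sphere. -/
theorem volO_succ (k : ℕ) : volO (k + 1) = Real.sqrt 2 ^ k * (volSphere k * volO k) := by
  rw [volO_add, volSphere_eq_two_mul_volGrassmannian, volO_one, mul_one]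
  ring

theorem volSphere_pos (k : ℕ) : 0 < volSphere k := by
  rw [volSphere_eq]
  have := Real.Gamma_pos_of_pos (show 0 < ((k : ℝ) + 1) / 2 by positivity)
  have := Real.pi_pos
  positivity

/-- Compute the volume of `O(e + d + 1)` by two fibrations: over `G_{d+1,e+d+1}`, and over the
sphere of dimension `e + d` with fibre `O(e + d)`, fibred in turn over `G_{d,e+d}`. -/
theorem volGrassmannian_succ (e d : ℕ) :
    volGrassmannian e (d + 1) * volSphere d = volGrassmannian e d * volSphere (e + d) := by
  have h1 := volO_add e (d + 1)
  rw [← add_assoc, volO_succ, volO_succ, volO_add e d] at h1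
  have h2 : Real.sqrt 2 ^ (e * (d + 1)) * Real.sqrt 2 ^ d =
      Real.sqrt 2 ^ (e + d) * Real.sqrt 2 ^ (e * d) := by
    rw [← pow_add, ← pow_add]; congr 1; ring
  have h3 : Real.sqrt 2 ^ (e + d) * Real.sqrt 2 ^ (e * d) * (volO e * volO d) ≠ 0 :=
    mul_ne_zero (by positivity) (mul_ne_zero (volO_ne_zero e) (volO_ne_zero d))
  apply mul_right_cancel₀ h3
  linear_combination -h1 - (volGrassmannian e (d + 1) * volO e * (volSphere d * volO d)) * h2

/-- The product formula for twice the volume of `G_{d,e+d}`. -/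
theorem two_mul_volGrassmannian (e : ℕ) {d : ℕ} (hd : 0 < d) :
    2 * volGrassmannian e d = (∏ j ∈ Finset.Icc e (e + d - 1), volSphere j) /
      ∏ j ∈ Finset.Icc 1 (d - 1), volSphere j := by
  have hne : ∀ s : Finset ℕ, ∏ j ∈ s, volSphere j ≠ 0 := fun s =>
    Finset.prod_ne_zero_iff.2 fun j _ => (volSphere_pos j).ne'
  induction d, hd using Nat.le_induction with
  | base => simp [volSphere_eq_two_mul_volGrassmannian]
  | succ d hd ih =>
    obtain ⟨c, rfl⟩ := Nat.exists_eq_add_of_le' hd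
    rw [eq_div_iff (hne _)] at ih ⊢
    have h1 := volGrassmannian_succ e (c + 1)
    simp only [← add_assoc, Nat.add_sub_cancel] at ih h1 ⊢
    rw [Finset.prod_Icc_succ_top (by omega), Finset.prod_Icc_succ_top (by omega), ← ih]
    linear_combination (2 * ∏ j ∈ Finset.Icc 1 c, volSphere j) * h1

/-- The quotient of the volumes of the special orthogonal groups is twice the volume of the
Grassmannian, since passing from `SO` to `O` doubles one factor of the
numerator and two of the denominator. -/
theorem volSO_quotient_eq {e d : ℕ} (he : 0 < e) (hd : 0 < d) :
    volSO (e + d) / (2 ^ (((d * e : ℕ) : ℝ) / 2) * volSO d * volSO e) =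
      2 * volGrassmannian e d := by
  have h1 := volO_add e d
  have h2 : Real.sqrt 2 ^ (e * d) = 2 ^ (((d * e : ℕ) : ℝ) / 2) := by
    rw [Real.sqrt_eq_rpow, ← Real.rpow_natCast, ← Real.rpow_mul (by norm_num)]
    congr 1
    push_cast
    ring
  have he0 := volO_ne_zero e
  have hd0 := volO_ne_zero d
  rw [volO_eq_two_mul_volSO (by omega)] at he0 hd0 h1
  rw [h2, volO_eq_two_mul_volSO he, volO_eq_two_mul_volSO hd] at h1
  have h3 : (2 : ℝ) ^ (((d * e : ℕ) : ℝ) / 2) ≠ 0 := by positivity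
  have he1 := right_ne_zero_of_mul he0
  have hd1 := right_ne_zero_of_mul hd0
  rw [div_eq_iff (by positivity)]
  linear_combination h1 / 2

/-! ### The Riemannian measure of the Grassmannian -/

theorem orbit_eq_univ {d n : ℕ} (σ : Gr d n) : MulAction.orbit (OG n) σ = univ :=
  MulAction.orbit_eq_univ _ _

theorem volGr_eq (e d : ℕ) {s : ℝ} (hs : 0 < s) :
    volGr d (e + d) s = s ^ (d * e) * volGrassmannian e d := by
  rw [volGr, grMeasure, Measure.smul_apply, Nat.add_sub_cancel, ← orbit_eq_univ (basePlane e d),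
    smul_eq_mul, ENNReal.toReal_mul, ENNReal.toReal_ofReal (by positivity), mul_comm d e]
  rfl

instance grMeasure.instIsFiniteMeasure {d n : ℕ} [Fact (d ≤ n)] {s : ℝ} :
    IsFiniteMeasure (grMeasure d n s) := by
  obtain ⟨e, rfl⟩ := Nat.exists_eq_add_of_le' (Fact.out : d ≤ n)
  refine ⟨?_⟩
  rw [grMeasure, Measure.smul_apply, Nat.add_sub_cancel, ← orbit_eq_univ (basePlane e d), smul_eq_mul,
    mul_comm d e]
  exact ENNReal.mul_lt_top ENNReal.ofReal_lt_top (measure_grassmannian_ne_top e d).lt_top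

/-- The Riemannian measure is the image of Haar measure, up to its total mass. -/
theorem grMeasure_eq_smul_map {d n : ℕ} [Fact (d ≤ n)] (s : ℝ) (σ : Gr d n) :
    grMeasure d n s = grMeasure d n s univ • (haarOG n).map (fun g => g • σ) := by
  refine eq_smul_map_of_invariant (haarOG n) (grMeasure d n s) (fun g => ?_) σ ?_
  · rw [grMeasure, Measure.map_smul]
    congr 1
    exact ((IsometryEquiv.constSMul (X := Gr d n)
      g).measurePreserving_euclideanHausdorffMeasure _).map_eq
  · rw [orbit_eq_univ]; simp

/-! ### Topology of the affine Grassmannian -/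

theorem Gr.compactSpace_of_point {d n : ℕ} (σ : Gr d n) : CompactSpace (Gr d n) := by
  have h : Continuous fun k : OG n => k • σ := continuous_id.smul continuous_const
  have hs : Function.Surjective fun k : OG n => k • σ := Gr.exists_smul_eq σ
  exact ⟨by rw [← hs.range_eq]; exact isCompact_range h⟩

instance Gr.instCompactSpace {d n : ℕ} : CompactSpace (Gr d n) := by
  rcases isEmpty_or_nonempty (Gr d n) with h | ⟨⟨σ⟩⟩
  · infer_instance
  · exact Gr.compactSpace_of_point σ

theorem Gr.continuous_starProjection {d n : ℕ} :
    Continuous fun p : Gr d n × E n => p.1.space.starProjection p.2 := by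
  have h : (fun p : Gr d n × E n => p.1.space.starProjection p.2) =
      fun p => WithLp.toLp 2 (p.1.projMatrix.mulVec (WithLp.ofLp p.2)) := by
    funext p
    rw [← Gr.projMatrix_mulVec]
    rfl
  rw [h]
  exact (PiLp.continuous_toLp 2 _).comp ((Gr.continuous_projMatrix.comp continuous_fst).matrix_mulVec
    ((PiLp.continuous_ofLp 2 _).comp continuous_snd))

theorem AffGr.continuous_through {d n : ℕ} :
    Continuous fun p : Gr d n × E n => AffGr.through p.1 p.2 :=
  (continuous_fst.prodMk (continuous_snd.sub Gr.continuous_starProjection)).subtype_mk _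

theorem AffGr.continuous_mk {d n : ℕ} (σ : Gr d n) : Continuous (AffGr.mk σ) :=
  (continuous_const.prodMk continuous_subtype_val).subtype_mk _

theorem AffGr.isClosed {d n : ℕ} : IsClosed {p : Gr d n × E n | p.2 ∈ p.1.spaceᗮ} := by
  have h : {p : Gr d n × E n | p.2 ∈ p.1.spaceᗮ} =
      (fun p : Gr d n × E n => p.1.space.starProjection p.2) ⁻¹' {0} := by
    ext p
    simp [Submodule.starProjection_apply_eq_zero_iff]
  rw [h]
  exact isClosed_singleton.preimage Gr.continuous_starProjection

theorem AffGr.isCompact_norm_le {d n : ℕ} (R : ℝ) : IsCompact {p : AffGr d n | ‖p.1.2‖ ≤ R} := by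
  have h : {p : AffGr d n | ‖p.1.2‖ ≤ R} =
      Subtype.val ⁻¹' ((univ : Set (Gr d n)) ×ˢ Metric.closedBall (0 : E n) R) := by
    ext p; simp
  rw [h]
  exact AffGr.isClosed.isClosedEmbedding_subtypeVal.isCompact_preimage
    (isCompact_univ.prod (isCompact_closedBall 0 R))

/-- All points of the plane `σ + x''` lie on the same plane parallel to `σ`. -/
theorem AffGr.through_add {d n : ℕ} (σ : Gr d n) (y : σ.space) (x : σ.spaceᗮ) :
    AffGr.through σ ((y : E n) + x) = AffGr.mk σ x := by
  have h : σ.space.starProjection ((y : E n) + x) = y := by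
    rw [map_add, Submodule.starProjection_eq_self_iff.2 y.2,
      (Submodule.starProjection_apply_eq_zero_iff _).2 x.2, add_zero]
  refine Subtype.ext (Prod.ext rfl ?_)
  change (y : E n) + x - σ.space.starProjection ((y : E n) + x) = x
  rw [h, add_sub_cancel_left]

/-! ### The integral of a function over the `d`-plane through a point -/

/-- A compactly supported function vanishes outside some ball around the origin. -/
theorem HasCompactSupport.exists_norm_lt {n : ℕ} {f : E n → ℂ} (hf : HasCompactSupport f) :
    ∃ R : ℝ, ∀ x, R < ‖x‖ → f x = 0 := by
  obtain ⟨R, hR⟩ := hf.isBounded.exists_norm_le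
  refine ⟨R, fun x hx => ?_⟩
  by_contra h
  exact absurd (hR x (subset_tsupport f h)) (not_le.2 hx)

/-- The integral of `f` over the `d`-plane `σ + x`, where `x` need not be orthogonal to `σ`. -/
def planeIntegral {d n : ℕ} (f : E n → ℂ) (σ : Gr d n) (x : E n) : ℂ :=
  ∫ y : σ.space, f (y + x)

theorem integrable_plane {d n : ℕ} {f : E n → ℂ} (hf : Continuous f) (hfs : HasCompactSupport f)
    (σ : Gr d n) (x : E n) : Integrable fun y : σ.space => f (y + x) := by
  obtain ⟨R, hR⟩ := hfs.exists_norm_lt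
  refine Continuous.integrable_of_hasCompactSupport (by fun_prop)
    (HasCompactSupport.intro (isCompact_closedBall (0 : σ.space) (R + ‖x‖)) fun y hy => hR _ ?_)
  rw [mem_closedBall_zero_iff, not_le, Submodule.coe_norm] at hy
  linarith [norm_le_norm_add_norm_sub' (y : E n) (y + x),
    show ‖(y : E n) - (y + x)‖ = ‖x‖ by rw [sub_add_cancel_left, norm_neg]]

/-- The orthogonal map `k` carries Lebesgue measure on `σ` to Lebesgue measure on `k • σ`, so that
the domain of integration can be kept fixed. -/
theorem planeIntegral_smul {d n : ℕ} (f : E n → ℂ) (σ : Gr d n) (k : OG n) (x : E n) :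
    planeIntegral f (k • σ) x = ∫ y : σ.space, f (k • (y : E n) + x) := by
  let e : σ.space ≃ₗᵢ[ℝ] (k • σ).space := LinearIsometryEquiv.submoduleMap σ.space k.toIsometryEquiv
  exact (e.measurePreserving.integral_comp e.toHomeomorph.measurableEmbedding
    (fun z : (k • σ).space => f (z + x))).symm

/-- The map `O(n) × ℝ^n → G_{d,n} × ℝ^n` given by a point of the Grassmannian is a quotient map, so
that continuity on the Grassmannian can be tested on the orthogonal group. -/
theorem Gr.isQuotientMap_smul_prod {d n : ℕ} (σ : Gr d n) :
    IsQuotientMap fun p : OG n × E n => (p.1 • σ, p.2) := by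
  have h : Continuous fun k : OG n => k • σ := continuous_id.smul continuous_const
  have hs : Function.Surjective fun k : OG n => k • σ := Gr.exists_smul_eq σ
  have hp : IsProperMap (Prod.map (fun k : OG n => k • σ) (id : E n → E n)) :=
    h.isProperMap.prodMap isProperMap_id
  exact hp.isClosedMap.isQuotientMap hp.continuous (hs.prodMap Function.surjective_id)

theorem continuous_planeIntegral {d n : ℕ} {f : E n → ℂ} (hf : Continuous f)
    (hfs : HasCompactSupport f) :
    Continuous fun p : Gr d n × E n => planeIntegral f p.1 p.2 := by
  rcases isEmpty_or_nonempty (Gr d n) with h | ⟨⟨σ⟩⟩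
  · exact continuous_of_const fun p => (h.false p.1).elim
  obtain ⟨R, hR⟩ := hfs.exists_norm_lt
  rw [(Gr.isQuotientMap_smul_prod σ).continuous_iff]
  change Continuous fun p : OG n × E n => planeIntegral f (p.1 • σ) p.2
  -- over the orthogonal group, the integrals are all over the fixed space `σ`
  simp_rw [planeIntegral_smul]
  rw [continuous_iff_continuousAt]
  intro p₀
  let s : Set (OG n × E n) := {p | ‖p.2‖ < ‖p₀.2‖ + 1}
  have hs : IsOpen s := isOpen_lt continuous_snd.norm continuous_const
  refine ContinuousOn.continuousAt (s := s) ?_ (hs.mem_nhds (by simp [s]))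
  refine continuousOn_integral_of_compact_support
    (isCompact_closedBall (0 : σ.space) (R + (‖p₀.2‖ + 1))) ?_ ?_
  · have h : Continuous fun q : (OG n × E n) × σ.space => q.1.1 • (q.2 : E n) + q.1.2 := by fun_prop
    exact (hf.comp h).continuousOn
  · intro p y hp hy
    apply hR
    have hp' : ‖p.2‖ < ‖p₀.2‖ + 1 := hp
    rw [mem_closedBall_zero_iff, not_le, Submodule.coe_norm] at hy
    have h1 := norm_le_norm_add_norm_sub' (p.1 • (y : E n)) (p.1 • (y : E n) + p.2)
    rw [sub_add_cancel_left, norm_neg, OG.norm_smul] at h1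
    linarith

/-! ### The transform of a compactly supported function -/

theorem continuous_dPlane {d n : ℕ} {f : E n → ℂ} (hf : Continuous f) (hfs : HasCompactSupport f) :
    Continuous (dPlane f : AffGr d n → ℂ) :=
  (continuous_planeIntegral hf hfs).comp continuous_subtype_val

/-- Every point of the plane `σ + x''` has norm at least `‖x''‖`. -/
theorem norm_le_norm_add_of_mem_orthogonal {n : ℕ} {K : Submodule ℝ (E n)} {x y : E n}
    (hy : y ∈ K) (hx : x ∈ Kᗮ) : ‖x‖ ≤ ‖y + x‖ := by
  have h := norm_add_sq_eq_norm_sq_add_norm_sq_real (hx y hy)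
  nlinarith [norm_nonneg x, norm_nonneg (y + x), mul_self_nonneg ‖y‖]

theorem dPlane_eq_zero {d n : ℕ} {f : E n → ℂ} {R : ℝ} (hR : ∀ x, R < ‖x‖ → f x = 0)
    {p : AffGr d n} (hp : R < ‖p.1.2‖) : dPlane f p = 0 := by
  have h : ∀ y : p.1.1.space, f (y + p.1.2) = 0 := fun y =>
    hR _ (hp.trans_le (norm_le_norm_add_of_mem_orthogonal y.2 p.2))
  simp [dPlane, h]

theorem hasCompactSupport_dPlane {d n : ℕ} {f : E n → ℂ} (hfs : HasCompactSupport f) :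
    HasCompactSupport (dPlane f : AffGr d n → ℂ) := by
  obtain ⟨R, hR⟩ := hfs.exists_norm_lt
  exact HasCompactSupport.intro (AffGr.isCompact_norm_le R) fun p hp =>
    dPlane_eq_zero hR (not_le.1 hp)

theorem integrable_mul_conj_dPlane {d n : ℕ} {φ : AffGr d n → ℂ} (hφ : Continuous φ) {f : E n → ℂ}
    (hf : Continuous f) (hfs : HasCompactSupport f) (σ : Gr d n) :
    Integrable fun x : σ.spaceᗮ => φ (AffGr.mk σ x) * conj (dPlane f (AffGr.mk σ x)) := by
  obtain ⟨R, hR⟩ := hfs.exists_norm_lt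
  have hm := AffGr.continuous_mk σ
  refine Continuous.integrable_of_hasCompactSupport ((hφ.comp hm).mul
    (Complex.continuous_conj.comp ((continuous_dPlane hf hfs).comp hm)))
    (HasCompactSupport.intro (isCompact_closedBall (0 : σ.spaceᗮ) R) fun x hx => ?_)
  rw [mem_closedBall_zero_iff, not_le] at hx
  rw [dPlane_eq_zero hR (p := AffGr.mk σ x) hx, map_zero, mul_zero]

/-! ### The adjoint -/

theorem continuous_through_mul_conj {d n : ℕ} {φ : AffGr d n → ℂ} (hφ : Continuous φ) {f : E n → ℂ}
    (hf : Continuous f) :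
    Continuous fun p : Gr d n × E n => φ (AffGr.through p.1 p.2) * conj (f p.2) :=
  (hφ.comp AffGr.continuous_through).mul
    (Complex.continuous_conj.comp (hf.comp continuous_snd))

/-- Fubini's theorem on `ℝ^n = σ ⊕ σ^⊥`. -/
theorem integral_orthogonal_mul_conj_dPlane {d n : ℕ} {φ : AffGr d n → ℂ} (hφ : Continuous φ)
    {f : E n → ℂ} (hf : Continuous f) (hfs : HasCompactSupport f) (σ : Gr d n) :
    ∫ x : σ.spaceᗮ, φ (AffGr.mk σ x) * conj (dPlane f (AffGr.mk σ x)) =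
      ∫ x, φ (AffGr.through σ x) * conj (f x) := by
  have hG : Integrable fun x : E n => φ (AffGr.through σ x) * conj (f x) :=
    Continuous.integrable_of_hasCompactSupport
      ((continuous_through_mul_conj hφ hf).comp (continuous_const.prodMk continuous_id))
      (hfs.mono fun x hx h => hx (by simp [h]))
  have hT : MeasurePreserving (fun p : σ.space × σ.spaceᗮ => (p.1 : E n) + p.2) :=
    σ.space.orthogonalDecomposition.symm.measurePreserving.comp (WithLp.volume_preserving_toLp _ _)
  have hemb : MeasurableEmbedding (fun p : σ.space × σ.spaceᗮ => (p.1 : E n) + p.2) :=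
    σ.space.orthogonalDecomposition.symm.toHomeomorph.measurableEmbedding.comp
      (MeasurableEquiv.toLp 2 _).measurableEmbedding
  have hint := (hT.integrable_comp_emb hemb).2 hG
  rw [Measure.volume_eq_prod] at hint
  rw [← hT.integral_comp hemb, Measure.volume_eq_prod]
  refine Eq.trans ?_ (integral_prod_symm _ hint).symm
  refine integral_congr_ae (ae_of_all _ fun x => ?_)
  simp only [Function.comp_apply, AffGr.through_add]
  rw [integral_const_mul, integral_conj]
  rfl

theorem affPairing_dPlane {d n : ℕ} {φ : AffGr d n → ℂ} (hφ : Continuous φ)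
    {f : E n → ℂ} (hf : Continuous f) (hfs : HasCompactSupport f) (s : ℝ) :
    affPairing s φ (dPlane f) =
      ∫ σ, (∫ x, φ (AffGr.through σ x) * conj (f x)) ∂(grMeasure d n s) := by
  simp only [affPairing, integral_orthogonal_mul_conj_dPlane hφ hf hfs]

theorem continuous_integral_through_mul_conj {d n : ℕ} {φ : AffGr d n → ℂ} (hφ : Continuous φ)
    {f : E n → ℂ} (hf : Continuous f) (hfs : HasCompactSupport f) :
    Continuous fun σ : Gr d n => ∫ x, φ (AffGr.through σ x) * conj (f x) := by
  rw [← continuousOn_univ]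
  refine continuousOn_integral_of_compact_support hfs
    (continuous_through_mul_conj hφ hf).continuousOn fun σ x _ hx => ?_
  rw [image_eq_zero_of_notMem_tsupport hx, map_zero, mul_zero]

theorem integrable_integral_through_mul_conj {d n : ℕ} [Fact (d ≤ n)] {φ : AffGr d n → ℂ}
    (hφ : Continuous φ) {f : E n → ℂ} (hf : Continuous f) (hfs : HasCompactSupport f) (s : ℝ) :
    Integrable (fun σ : Gr d n => ∫ x, φ (AffGr.through σ x) * conj (f x)) (grMeasure d n s) :=
  (continuous_integral_through_mul_conj hφ hf hfs).integrable_of_hasCompactSupport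
    (HasCompactSupport.of_compactSpace _)

/-- Interchanging the two integrals turns the pairing of `φ` with the transform of `f` into the
pairing of `f` with the function `x ↦ ∫ φ(σ, x - π_σ x) dσ`. -/
theorem affPairing_dPlane_swap {d n : ℕ} [Fact (d ≤ n)] {φ : AffGr d n → ℂ} (hφ : Continuous φ)
    {f : E n → ℂ} (hf : Continuous f) (hfs : HasCompactSupport f) (s : ℝ) :
    affPairing s φ (dPlane f) =
      ∫ x, (∫ σ, φ (AffGr.through σ x) ∂(grMeasure d n s)) * conj (f x) := by
  rw [affPairing_dPlane hφ hf hfs, integral_integral_swap_of_hasCompactSupport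
    (continuous_through_mul_conj hφ hf)]
  · simp_rw [integral_mul_const]
  · refine HasCompactSupport.intro (isCompact_univ.prod hfs) fun p hp => ?_
    have hx : p.2 ∉ tsupport f := fun h => hp ⟨mem_univ _, h⟩
    change φ (AffGr.through p.1 p.2) * conj (f p.2) = 0
    rw [image_eq_zero_of_notMem_tsupport hx, map_zero, mul_zero]

/-! ### Integration over the homogeneous space -/

theorem measurable_quotient_mk {d n : ℕ} (σ : Gr d n) :
    Measurable (QuotientGroup.mk : OG n → OGQuot σ) := measurable_quotient_mk''

theorem OGQuot.measurable_act {d n : ℕ} (σ : Gr d n) :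
    Measurable (OGQuot.act : OGQuot σ → Gr d n) :=
  measurable_from_quotient.2 (by
    have h : Continuous fun k : OG n => k • σ := continuous_id.smul continuous_const
    exact h.measurable)

theorem aestronglyMeasurable_comp_act {d n : ℕ} (σ : Gr d n) {ψ : Gr d n → ℂ} (hψ : Continuous ψ) :
    AEStronglyMeasurable (fun k : OGQuot σ => ψ k.act) (invMeasure σ) :=
  (hψ.measurable.comp (OGQuot.measurable_act σ)).aestronglyMeasurable

theorem integrable_comp_act {d n : ℕ} (σ : Gr d n) {ψ : Gr d n → ℂ} (hψ : Continuous ψ) :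
    Integrable (fun k : OGQuot σ => ψ k.act) (invMeasure σ) := by
  have h : Continuous fun k : OG n => ψ (k • σ) := hψ.comp (continuous_id.smul continuous_const)
  exact (integrable_map_measure (aestronglyMeasurable_comp_act σ hψ)
    (measurable_quotient_mk σ).aemeasurable).2
    (h.integrable_of_hasCompactSupport (HasCompactSupport.of_compactSpace _))

/-- An integral over the homogeneous space is one over the group. -/
theorem integral_comp_act {d n : ℕ} (σ : Gr d n) {ψ : Gr d n → ℂ} (hψ : Continuous ψ) :
    ∫ k : OGQuot σ, ψ k.act ∂(invMeasure σ) = ∫ k, ψ (k • σ) ∂(haarOG n) :=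
  integral_map (measurable_quotient_mk σ).aemeasurable (aestronglyMeasurable_comp_act σ hψ)

/-- Integration over the Grassmannian is integration over the homogeneous space
`O(n) / (O(d) × O(n-d))`, multiplied by the volume. -/
theorem integral_grMeasure {d n : ℕ} [Fact (d ≤ n)] (s : ℝ) (σ : Gr d n) {ψ : Gr d n → ℂ}
    (hψ : Continuous ψ) :
    ∫ τ, ψ τ ∂(grMeasure d n s) =
      (volGr d n s : ℂ) * ∫ k : OGQuot σ, ψ k.act ∂(invMeasure σ) := by
  have h : Continuous fun k : OG n => k • σ := continuous_id.smul continuous_const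
  rw [grMeasure_eq_smul_map s σ, integral_smul_measure, integral_map h.measurable.aemeasurable
    hψ.aestronglyMeasurable, integral_comp_act σ hψ, volGr, Complex.real_smul]

theorem continuous_integral_grMeasure {d n : ℕ} [Fact (d ≤ n)] {φ : AffGr d n → ℂ}
    (hφ : Continuous φ) (s : ℝ) :
    Continuous fun x : E n => ∫ σ, φ (AffGr.through σ x) ∂(grMeasure d n s) := by
  have h : Continuous (Function.uncurry fun (x : E n) (σ : Gr d n) => φ (AffGr.through σ x)) :=
    hφ.comp (AffGr.continuous_through.comp continuous_swap)
  simpa using continuous_parametric_integral_of_continuous (μ := grMeasure d n s) h isCompact_univ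

/-- Two locally integrable functions which represent the same functional on compactly supported
continuous functions agree almost everywhere. -/
theorem IsAdjointValue.ae_eq {d n : ℕ} {s : ℝ} {φ : AffGr d n → ℂ} {h h' : E n → ℂ}
    (hl : LocallyIntegrable h) (hl' : LocallyIntegrable h') (hh : IsAdjointValue s φ h)
    (hh' : IsAdjointValue s φ h') : h =ᵐ[volume] h' := by
  refine ae_eq_of_integral_contDiff_smul_eq hl hl' fun g hg hgs => ?_
  have hf : Continuous fun x => (g x : ℂ) := Complex.continuous_ofReal.comp hg.continuous
  have hfs : HasCompactSupport fun x => (g x : ℂ) := hgs.comp_left Complex.ofReal_zero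
  have h1 := (hh _ hf hfs).symm.trans (hh' _ hf hfs)
  simpa only [Complex.conj_ofReal, Complex.real_smul, mul_comm] using h1

end

theorem mainTheorem2 (n d : ℕ) (hn : 2 ≤ n) (hd : 0 < d) (hdn : d < n) :
    -- the volumes of the unit spheres
    (∀ k : ℕ, volSphere k = 2 * Real.pi ^ (((k : ℝ) + 1) / 2) / Real.Gamma (((k : ℝ) + 1) / 2)) ∧
    -- the two expressions in the volume formula agree
    (volSO n / (2 ^ (((d * (n - d) : ℕ) : ℝ) / 2) * volSO d * volSO (n - d)) =
      (∏ j ∈ Finset.Icc (n - d) (n - 1), volSphere j) / ∏ j ∈ Finset.Icc 1 (d - 1), volSphere j) ∧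
    -- the volume of the Grassmannian for each scale of the invariant metric
    (∀ s : ℝ, 0 < s →
      volGr d n s = s ^ (d * (n - d)) / 2 *
        (volSO n / (2 ^ (((d * (n - d) : ℕ) : ℝ) / 2) * volSO d * volSO (n - d)))) ∧
    -- the scale for which this is the volume formula without a factor
    (∀ s : ℝ, 0 < s → s ^ (d * (n - d)) = 2 →
      volGr d n s = volSO n / (2 ^ (((d * (n - d) : ℕ) : ℝ) / 2) * volSO d * volSO (n - d)) ∧
      volGr d n s =
        (∏ j ∈ Finset.Icc (n - d) (n - 1), volSphere j) /
          ∏ j ∈ Finset.Icc 1 (d - 1), volSphere j) ∧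
    -- the transform of a compactly supported continuous function
    (∀ f : E n → ℂ, Continuous f → HasCompactSupport f →
      (∀ p : AffGr d n, Integrable fun x' : p.1.1.space => f (x' + p.1.2)) ∧
      Continuous (dPlane f : AffGr d n → ℂ) ∧ HasCompactSupport (dPlane f : AffGr d n → ℂ)) ∧
    -- the adjoint
    (∀ s : ℝ, 0 < s → ∀ φ : AffGr d n → ℂ, Continuous φ →
      (∀ f : E n → ℂ, Continuous f → HasCompactSupport f →
        (∀ σ : Gr d n, Integrable fun x'' : σ.spaceᗮ =>
          φ (AffGr.mk σ x'') * conj (dPlane f (AffGr.mk σ x''))) ∧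
        Integrable (fun σ : Gr d n => ∫ x'' : σ.spaceᗮ,
          φ (AffGr.mk σ x'') * conj (dPlane f (AffGr.mk σ x''))) (grMeasure d n s)) ∧
      ∀ (σ : Gr d n) (Rφ : E n → ℂ),
        (∀ x, Rφ x =
          (volGr d n s : ℂ) * ∫ k : OGQuot σ, φ (AffGr.through k.act x) ∂(invMeasure σ)) →
        (∀ x, Integrable (fun k : OGQuot σ => φ (AffGr.through k.act x)) (invMeasure σ)) ∧
        Continuous Rφ ∧
        IsAdjointValue s φ Rφ ∧
        ∀ h : E n → ℂ, LocallyIntegrable h → IsAdjointValue s φ h → h =ᵐ[volume] Rφ) := by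
  obtain ⟨e, rfl⟩ := Nat.exists_eq_add_of_le' hdn.le
  have he : 0 < e := by omega
  have : Fact (d ≤ e + d) := ⟨hdn.le⟩
  have hV := volSO_quotient_eq he hd
  have hP := two_mul_volGrassmannian e hd
  simp only [Nat.add_sub_cancel]
  refine ⟨volSphere_eq, hV.trans hP, fun s hs => ?_, fun s hs h2 => ?_, fun f hf hfs =>
    ⟨fun p => integrable_plane hf hfs _ _, continuous_dPlane hf hfs, hasCompactSupport_dPlane hfs⟩,
    fun s _ φ hφ => ⟨fun f hf hfs => ⟨integrable_mul_conj_dPlane hφ hf hfs, ?_⟩,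
      fun σ Rφ hR => ?_⟩⟩
  · rw [hV, volGr_eq e d hs]; ring
  · rw [hV, ← hP, volGr_eq e d hs, h2]; exact ⟨rfl, rfl⟩
  · simp_rw [integral_orthogonal_mul_conj_dPlane hφ hf hfs]
    exact integrable_integral_through_mul_conj hφ hf hfs s
  · have hc : ∀ x : E (e + d), Continuous fun τ : Gr d (e + d) => φ (AffGr.through τ x) := fun x =>
      hφ.comp (AffGr.continuous_through.comp (continuous_id.prodMk continuous_const))
    obtain rfl : Rφ = fun x => ∫ τ, φ (AffGr.through τ x) ∂(grMeasure d (e + d) s) :=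
      funext fun x => (hR x).trans (integral_grMeasure s σ (hc x)).symm
    have hcont := continuous_integral_grMeasure hφ s
    have hadj : IsAdjointValue s φ fun x => ∫ τ, φ (AffGr.through τ x) ∂(grMeasure d (e + d) s) :=
      fun f hf hfs => affPairing_dPlane_swap hφ hf hfs s
    exact ⟨fun x => integrable_comp_act σ (hc x), hcont, hadj, fun h hl hh =>
      hh.ae_eq hl hcont.locallyIntegrable hadj⟩
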